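/- All functions are complex valued. For $\xi\in\mathbb R^N$ let $e_\xi(y)=e^{i\xi\cdot y}$ and let $\mathrm{Trig}(\mathbb R^N)$ be the complex span of the $e_\xi$; $CAP(\mathbb R^N)$ is its closure for uniform convergence, and $\mathcal B^2(\mathbb R^N)$ is the space of functions $u\in L^2_{loc}(\mathbb R^N)$ such that for every $\delta>0$ there is $p\in \mathrm{Trig}(\mathbb R^N)$ with $\limsup_{n}\frac1{|B(0,n)|}\int_{B(0,n)}|u-p|^2\,dy<\delta$, with the seminorm $\big(\limsup_n\frac1{|B(0,n)|}\int_{B(0,n)}|u|^2dy\big)^{1/2}$ (functions at distance $0$ are identified). $M(u)$ denotes the mean value of $u$, i.e. $M(u)=\lim_{n\to\infty}\frac1{|n\omega|}\int_{n\omega}u\,dy$ for every bounded measurable $\omega\subset\mathbb R^N$ with $|\omega|>0$. An element of $\mathcal B^2(\mathbb R^N)$ is identified with the formal series $\sum_\xi a_\xi e^{i\xi\cdot y}$, $a_\xi=M(e^{-i\xi\cdot y}u)$, and derivatives are taken on the formal series: $\partial_{y_j}\sum_\xi a_\xi e^{i\xi\cdot y}=i\sum_\xi\xi_j a_\xi e^{i\xi\cdot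 y}$. Given $\varepsilon_n>0$, $\varepsilon_n\to0$, and $\Omega\subset\mathbb R^N$ open, a sequence $u_n\in L^2(\Omega)$ two-scale converges to $\hat u\in L^2(\Omega;\mathcal B^2(\mathbb R^N))$ in $\Omega$ if for every $\psi\in C^0_c(\Omega;CAP(\mathbb R^N))$ $$\lim_{n\to\infty}\int_\Omega u_n(x)\,\psi\big(x,\tfrac{x}{\varepsilon_n}\big)\,dx=\int_\Omega M\big(\hat u(x,\cdot)\psi(x,\cdot)\big)\,dx .$$ **Proposition.** Let $T>0$, let $\varepsilon_n>0$ with $\varepsilon_n\to 0$, and let $P\in L^\infty(\mathbb R^3)^{3\times3}$ be periodic with period the unit cube, hermitian, and such that $P(y)\eta\cdot\overline\eta\ge\alpha|\eta|^2$ for some $\alpha>0$, all $\eta\in\mathbb C^3$ and a.e. $y\in\mathbb R^3$. Let $f_n,g_n$ be bounded in $L^2((0,T)\times\mathbb R^3)^3$ and $B^0_n,E^0_n$ be bounded in $L^2(\mathbb R^3)^3$, and assume that the distributional divergences satisfy $$\mathrm{div}_xf_n,\ \mathrm{div}_xg_n\ \text{ bounded in } L^2((0,T)\times\mathbb R^3),\qquad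 \mathrm{div}_x\big(P\big(\tfrac{x}{\varepsilon_n}\big)E^0_n\big),\ \mathrm{div}_xB^0_n\ \text{ bounded in } L^2(\mathbb R^3).$$ Let $\hat f,\hat g\in L^2((0,T)\times\mathbb R^3;\mathcal B^2(\mathbb R^4))^3$ and $\hat B^0,\hat E^0\in L^2(\mathbb R^3;\mathcal B^2(\mathbb R^3))^3$ be such that, componentwise, $f_n,g_n$ two-scale converge to $\hat f,\hat g$ in $(0,T)\times\mathbb R^3$ (with fast variables $(s,y)\in\mathbb R\times\mathbb R^3$) and $B^0_n,E^0_n$ two-scale converge to $\hat B^0,\hat E^0$ in $\mathbb R^3$ (with fast variable $y\in\mathbb R^3$). Then $$\mathrm{div}_y\hat f=\mathrm{div}_y\hat g=0\ \text{ for a.e. }(t,x)\in(0,T)\times\mathbb R^3,$$ and, for a.e. $x\in\mathbb R^3$, $P\hat E^0(x,\cdot)\in\mathcal B^2(\mathbb R^3)^3$ and $$\mathrm{div}_y\hat B^0=\mathrm{div}_y\big(P\hat E^0\big)=0 .$$ -/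

import Mathlib

open MeasureTheory Filter Topology Set
open scoped ENNReal NNReal Pointwise BoundedContinuousFunction

noncomputable section

namespace TwoScaleMaxwell

/-- `ℝ^N` with its Euclidean norm. -/
abbrev Euc (N : ℕ) : Type := EuclideanSpace ℝ (Fin N)

/-! ### Trigonometric polynomials, Bohr and Besicovitch almost periodic functions -/

/-- `Trig(ℝ^N)`: the complex span of the functions `y ↦ e^{i ξ·y}`, `ξ ∈ ℝ^N`. -/
def trig (N : ℕ) : Submodule ℂ (Euc N →ᵇ ℂ) :=
  Submodule.span ℂ (Set.range fun ξ : Euc N => BoundedContinuousFunction.innerProbChar ξ)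

/-- `CAP(ℝ^N)`: the closure of `Trig(ℝ^N)` for uniform convergence. -/
def bohrAP (N : ℕ) : Submodule ℂ (Euc N →ᵇ ℂ) := (trig N).topologicalClosure

/-- The upper quadratic mean `limsup_n |B(0,n)|⁻¹ ∫_{B(0,n)} |u|² dy`. -/
def upperMeanSq {N : ℕ} (u : Euc N → ℂ) : ℝ≥0∞ :=
  limsup (fun n : ℕ => (volume (Metric.ball (0 : Euc N) n))⁻¹ *
    ∫⁻ y in Metric.ball (0 : Euc N) n, ‖u y‖ₑ ^ 2) atTop

/-- `u` is almost periodic in the sense of Besicovitch: `u ∈ L²_loc(ℝ^N)` and `u` can be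
approximated by trigonometric polynomials for the upper quadratic mean. -/
structure IsBesicovitch {N : ℕ} (u : Euc N → ℂ) : Prop where
  locL2 : ∀ K : Set (Euc N), IsCompact K → MemLp u 2 (volume.restrict K)
  approx : ∀ δ : ℝ≥0∞, 0 < δ → ∃ p ∈ trig N, upperMeanSq (fun y => u y - p y) < δ

lemma upperMeanSq_rpow {N : ℕ} (u : Euc N → ℂ) :
    upperMeanSq u ^ (1 / 2 : ℝ) = limsup (fun n : ℕ => eLpNorm u 2
      ((volume (Metric.ball (0 : Euc N) n))⁻¹ • volume.restrict (Metric.ball (0 : Euc N) n)))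
      atTop := by
  have h := OrderIso.limsup_apply (f := atTop)
    (u := fun n : ℕ => (volume (Metric.ball (0 : Euc N) n))⁻¹ *
      ∫⁻ y in Metric.ball (0 : Euc N) n, ‖u y‖ₑ ^ 2)
    (ENNReal.orderIsoRpow (1 / 2) (by norm_num))
  refine h.trans ?_
  congr 1
  funext n
  rw [eLpNorm_eq_lintegral_rpow_enorm_toReal two_ne_zero ENNReal.ofNat_ne_top]
  simp [ENNReal.orderIsoRpow]

lemma IsBesicovitch.aestronglyMeasurable {N : ℕ} {u : Euc N → ℂ}
    (hu : ∀ K : Set (Euc N), IsCompact K → MemLp u 2 (volume.restrict K)) (n : ℕ) :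
    AEStronglyMeasurable u
      ((volume (Metric.ball (0 : Euc N) n))⁻¹ • volume.restrict (Metric.ball (0 : Euc N) n)) :=
  (((hu _ (isCompact_closedBall (0 : Euc N) n)).aestronglyMeasurable).mono_measure
    (Measure.restrict_mono Metric.ball_subset_closedBall le_rfl)).smul_measure _

lemma limsup_add_le_ennreal (a b : ℕ → ℝ≥0∞) :
    limsup (fun n => a n + b n) atTop ≤ limsup a atTop + limsup b atTop := by
  refine ENNReal.le_of_forall_pos_le_add fun δ hδ hfin => ?_
  have hA : limsup a atTop < ∞ := lt_of_le_of_lt le_self_add hfin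
  have hB : limsup b atTop < ∞ := lt_of_le_of_lt le_add_self hfin
  have hδ' : (0 : ℝ≥0∞) < (δ : ℝ≥0∞) / 2 := ENNReal.half_pos (by exact_mod_cast hδ.ne')
  have ha := eventually_lt_of_limsup_lt (ENNReal.lt_add_right hA.ne hδ'.ne')
  have hb := eventually_lt_of_limsup_lt (ENNReal.lt_add_right hB.ne hδ'.ne')
  refine limsup_le_of_le (by isBoundedDefault) ?_
  filter_upwards [ha, hb] with n h1 h2
  calc a n + b n ≤ (limsup a atTop + δ / 2) + (limsup b atTop + δ / 2) :=
        add_le_add h1.le h2.le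
    _ = limsup a atTop + limsup b atTop + (δ / 2 + δ / 2) := by ring
    _ = limsup a atTop + limsup b atTop + δ := by rw [ENNReal.add_halves]

lemma upperMeanSq_add_rpow_le {N : ℕ} {u v : Euc N → ℂ}
    (hu : ∀ K : Set (Euc N), IsCompact K → MemLp u 2 (volume.restrict K))
    (hv : ∀ K : Set (Euc N), IsCompact K → MemLp v 2 (volume.restrict K)) :
    upperMeanSq (u + v) ^ (1 / 2 : ℝ) ≤
      upperMeanSq u ^ (1 / 2 : ℝ) + upperMeanSq v ^ (1 / 2 : ℝ) := by
  rw [upperMeanSq_rpow, upperMeanSq_rpow, upperMeanSq_rpow]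
  refine le_trans ?_ (limsup_add_le_ennreal _ _)
  exact limsup_le_limsup (Eventually.of_forall fun n => eLpNorm_add_le
    (IsBesicovitch.aestronglyMeasurable hu n) (IsBesicovitch.aestronglyMeasurable hv n)
    one_le_two)

lemma upperMeanSq_smul_rpow {N : ℕ} (c : ℂ) (u : Euc N → ℂ) :
    upperMeanSq (c • u) ^ (1 / 2 : ℝ) = ‖c‖ₑ * upperMeanSq u ^ (1 / 2 : ℝ) := by
  rw [upperMeanSq_rpow, upperMeanSq_rpow, ← ENNReal.limsup_const_mul_of_ne_top enorm_ne_top]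
  congr 1
  funext n
  exact eLpNorm_const_smul c u 2 _

lemma trig_locL2 {N : ℕ} (p : Euc N →ᵇ ℂ) (K : Set (Euc N)) (hK : IsCompact K) :
    MemLp (fun y => p y) 2 (volume.restrict K) := by
  have : IsFiniteMeasure (volume.restrict K) := ⟨by simpa using hK.measure_lt_top⟩
  exact MemLp.of_bound p.continuous.aestronglyMeasurable ‖p‖
    (Eventually.of_forall fun y => p.norm_coe_le_norm y)

lemma upperMeanSq_bdd_lt_top {N : ℕ} (p : Euc N →ᵇ ℂ) : upperMeanSq (fun y => p y) < ∞ := by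
  have h : upperMeanSq (fun y => p y) ≤ ‖p‖ₑ ^ 2 := by
    refine limsup_le_of_le (by isBoundedDefault) (Eventually.of_forall fun n => ?_)
    calc (volume (Metric.ball (0 : Euc N) n))⁻¹ *
          ∫⁻ y in Metric.ball (0 : Euc N) n, ‖p y‖ₑ ^ 2
        ≤ (volume (Metric.ball (0 : Euc N) n))⁻¹ *
          ∫⁻ _ in Metric.ball (0 : Euc N) n, ‖p‖ₑ ^ 2 := by
          gcongr with y
          exact enorm_le_iff_norm_le.2 (p.norm_coe_le_norm y)
      _ = ‖p‖ₑ ^ 2 * ((volume (Metric.ball (0 : Euc N) n))⁻¹ *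
            volume (Metric.ball (0 : Euc N) n)) := by
          rw [setLIntegral_const]; ring
      _ ≤ ‖p‖ₑ ^ 2 * 1 := by gcongr; exact ENNReal.inv_mul_le_one _
      _ = ‖p‖ₑ ^ 2 := mul_one _
  exact lt_of_le_of_lt h (ENNReal.pow_lt_top enorm_lt_top)

lemma IsBesicovitch.approx_rpow {N : ℕ} {u : Euc N → ℂ} (hu : IsBesicovitch u) (η : ℝ≥0∞)
    (hη : 0 < η) : ∃ p ∈ trig N, upperMeanSq (u - fun y => p y) ^ (1 / 2 : ℝ) < η := by
  obtain ⟨p, hp, h⟩ := hu.approx (η ^ (2 : ℝ)) (ENNReal.rpow_pos_of_nonneg hη (by norm_num))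
  refine ⟨p, hp, ?_⟩
  have h' := ENNReal.rpow_lt_rpow h (z := 1 / 2) (by norm_num)
  rw [← ENNReal.rpow_mul] at h'
  norm_num at h' ⊢
  exact h'

lemma IsBesicovitch.of_rpow {N : ℕ} {u : Euc N → ℂ}
    (h : ∀ K : Set (Euc N), IsCompact K → MemLp u 2 (volume.restrict K))
    (h' : ∀ η : ℝ≥0∞, 0 < η →
      ∃ p ∈ trig N, upperMeanSq (u - fun y => p y) ^ (1 / 2 : ℝ) < η) : IsBesicovitch u := by
  refine ⟨h, fun δ hδ => ?_⟩
  obtain ⟨p, hp, hlt⟩ := h' (δ ^ (1 / 2 : ℝ)) (ENNReal.rpow_pos_of_nonneg hδ (by norm_num))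
  exact ⟨p, hp, (ENNReal.rpow_lt_rpow_iff (by norm_num)).1 hlt⟩

lemma IsBesicovitch.add {N : ℕ} {u v : Euc N → ℂ} (hu : IsBesicovitch u)
    (hv : IsBesicovitch v) : IsBesicovitch (u + v) := by
  refine .of_rpow (fun K hK => (hu.locL2 K hK).add (hv.locL2 K hK)) fun η hη => ?_
  obtain ⟨p, hp, h1⟩ := hu.approx_rpow (η / 2) (ENNReal.half_pos hη.ne')
  obtain ⟨q, hq, h2⟩ := hv.approx_rpow (η / 2) (ENNReal.half_pos hη.ne')
  refine ⟨p + q, add_mem hp hq, ?_⟩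
  have e : ((u + v) - fun y => (p + q) y) = (u - fun y => p y) + (v - fun y => q y) := by
    funext y; simp; ring
  rw [e]
  refine lt_of_le_of_lt (upperMeanSq_add_rpow_le
    (fun K hK => (hu.locL2 K hK).sub (trig_locL2 p K hK))
    (fun K hK => (hv.locL2 K hK).sub (trig_locL2 q K hK))) ?_
  calc _ < η / 2 + η / 2 := ENNReal.add_lt_add h1 h2
    _ = η := ENNReal.add_halves η

lemma isBesicovitch_bdd {N : ℕ} {p : Euc N →ᵇ ℂ} (hp : p ∈ trig N) :
    IsBesicovitch (fun y => p y) :=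
  ⟨fun K hK => trig_locL2 p K hK, fun δ hδ => ⟨p, hp, by simpa [upperMeanSq] using hδ⟩⟩

lemma IsBesicovitch.smul {N : ℕ} {u : Euc N → ℂ} (c : ℂ) (hu : IsBesicovitch u) :
    IsBesicovitch (c • u) := by
  refine .of_rpow (fun K hK => (hu.locL2 K hK).const_smul c) fun η hη => ?_
  have hc : ‖c‖ₑ + 1 ≠ ∞ := by simp
  obtain ⟨p, hp, h1⟩ := hu.approx_rpow (η / (‖c‖ₑ + 1)) (ENNReal.div_pos hη.ne' hc)
  refine ⟨c • p, Submodule.smul_mem _ c hp, ?_⟩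
  have e : (c • u - fun y => (c • p) y) = c • (u - fun y => p y) := by
    funext y; simp; ring
  rw [e, upperMeanSq_smul_rpow]
  refine lt_of_le_of_lt (mul_le_mul_left le_self_add _ : _ ≤ (‖c‖ₑ + 1) * _) ?_
  rw [mul_comm]
  exact (ENNReal.lt_div_iff_mul_lt (by simp) (by simp)).1 h1

lemma IsBesicovitch.upperMeanSq_lt_top {N : ℕ} {u : Euc N → ℂ} (hu : IsBesicovitch u) :
    upperMeanSq u ^ (1 / 2 : ℝ) < ∞ := by
  obtain ⟨p, hp, h⟩ := hu.approx_rpow ∞ (by simp)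
  have e : u = (u - fun y => p y) + fun y => p y := by simp
  rw [e]
  exact lt_of_le_of_lt (upperMeanSq_add_rpow_le
    (fun K hK => (hu.locL2 K hK).sub (trig_locL2 p K hK)) (fun K hK => trig_locL2 p K hK))
    (ENNReal.add_lt_top.2
      ⟨h, ENNReal.rpow_lt_top_of_nonneg (by norm_num) (upperMeanSq_bdd_lt_top p).ne⟩)

/-- The Besicovitch functions as a subspace of all functions `ℝ^N → ℂ`. -/
def besicovitchSubmodule (N : ℕ) : Submodule ℂ (Euc N → ℂ) where
  carrier := {u | IsBesicovitch u}
  add_mem' := IsBesicovitch.add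
  zero_mem' := isBesicovitch_bdd (zero_mem (trig N))
  smul_mem' c _ hu := hu.smul c

/-- The space `𝓑²(ℝ^N)`. Its elements are represented by functions, and it carries the seminorm
`(limsup_n |B(0,n)|⁻¹ ∫_{B(0,n)} |u|²)^{1/2} = M(|u|²)^{1/2}`. Two functions at distance zero for
this seminorm represent the same almost periodic function. -/
def Besicovitch (N : ℕ) : Type := besicovitchSubmodule N

namespace Besicovitch

variable {N : ℕ}

instance : AddCommGroup (Besicovitch N) := inferInstanceAs (AddCommGroup (besicovitchSubmodule N))

instance : Module ℂ (Besicovitch N) := inferInstanceAs (Module ℂ (besicovitchSubmodule N))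

instance : CoeFun (Besicovitch N) fun _ => Euc N → ℂ := ⟨fun u => u.1⟩

instance : Norm (Besicovitch N) := ⟨fun u => (upperMeanSq u ^ (1 / 2 : ℝ)).toReal⟩

lemma core (N : ℕ) : SeminormedSpace.Core ℂ (Besicovitch N) where
  norm_nonneg _ := ENNReal.toReal_nonneg
  norm_smul c u := by
    change (upperMeanSq (c • u.1) ^ (1 / 2 : ℝ)).toReal
      = ‖c‖ * (upperMeanSq u.1 ^ (1 / 2 : ℝ)).toReal
    rw [upperMeanSq_smul_rpow, ENNReal.toReal_mul, toReal_enorm]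
  norm_triangle u v := by
    change (upperMeanSq (u.1 + v.1) ^ (1 / 2 : ℝ)).toReal
      ≤ (upperMeanSq u.1 ^ (1 / 2 : ℝ)).toReal + (upperMeanSq v.1 ^ (1 / 2 : ℝ)).toReal
    have hu : IsBesicovitch u.1 := u.2
    have hv : IsBesicovitch v.1 := v.2
    rw [← ENNReal.toReal_add hu.upperMeanSq_lt_top.ne hv.upperMeanSq_lt_top.ne]
    exact ENNReal.toReal_mono
      (ENNReal.add_lt_top.2 ⟨hu.upperMeanSq_lt_top, hv.upperMeanSq_lt_top⟩).ne
      (upperMeanSq_add_rpow_le hu.locL2 hv.locL2)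

instance : SeminormedAddCommGroup (Besicovitch N) := SeminormedAddCommGroup.ofCore (core N)

end Besicovitch

/-! ### Mean values, Fourier coefficients and the divergence in the fast variable -/

/-- `u ∈ L¹_loc(ℝ^N)` has the mean value `m`: for every bounded measurable `ω` of positive
measure, the averages of `u` over `nω` tend to `m`. -/
structure HasMeanValue {N : ℕ} (u : Euc N → ℂ) (m : ℂ) : Prop where
  locInt : LocallyIntegrable u
  tendsto : ∀ ω : Set (Euc N), Bornology.IsBounded ω → MeasurableSet ω → volume ω ≠ 0 →
    Tendsto (fun n : ℕ => ⨍ y in (n : ℝ) • ω, u y) atTop (𝓝 m)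

open Classical in
/-- The mean value `M(u)`; by convention `0` for a function without mean value. -/
def meanValue {N : ℕ} (u : Euc N → ℂ) : ℂ :=
  if h : ∃ m, HasMeanValue u m then h.choose else 0

/-- The coefficient `a_ξ = M(e^{-i ξ·y} u)` of the formal series `u = ∑_ξ a_ξ e^{i ξ·y}`. -/
def fourierCoeff {N : ℕ} (u : Euc N → ℂ) (ξ : Euc N) : ℂ :=
  meanValue fun y => Complex.exp (-(Complex.I * (inner ℝ ξ y : ℝ))) * u y

/-- The divergence with respect to the three coordinates `σ 0, σ 1, σ 2` of `ℝ^N` of a vector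
field with components in `𝓑²(ℝ^N)`, as a formal series, i.e. through its family of coefficients:
`∂_k (∑_ξ a_ξ e^{i ξ·y}) = i ∑_ξ ξ_k a_ξ e^{i ξ·y}`. -/
def formalDiv {N : ℕ} (σ : Fin 3 → Fin N) (u : Fin 3 → Euc N → ℂ) : Euc N → ℂ :=
  fun ξ => ∑ j, Complex.I * (ξ (σ j) : ℂ) * fourierCoeff (u j) ξ

/-! ### Two-scale convergence, weak divergence, and the data -/

/-- `u_n` (a sequence in `L²(Ω)`, attached to the sequence of scales `ε_n`) two-scale converges to
`û ∈ L²(Ω; 𝓑²(ℝ^N))`. The test functions are those of `C⁰_c(Ω; CAP(ℝ^N))`. -/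
structure TwoScaleTendsto {N : ℕ} (Ω : Set (Euc N)) (ε : ℕ → ℝ) (u : ℕ → Euc N → ℂ)
    (uhat : Euc N → Besicovitch N) : Prop where
  memLp : ∀ n, MemLp (u n) 2 (volume.restrict Ω)
  memLp_limit : MemLp uhat 2 (volume.restrict Ω)
  tendsto : ∀ ψ : Euc N → (Euc N →ᵇ ℂ), Continuous ψ → HasCompactSupport ψ → tsupport ψ ⊆ Ω →
    (∀ x, ψ x ∈ bohrAP N) →
    Tendsto (fun n => ∫ x in Ω, u n x * ψ x ((ε n)⁻¹ • x)) atTop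
      (𝓝 (∫ x in Ω, meanValue fun y => uhat x y * ψ x y))

/-- The sequence `u_n` is bounded in `L²(Ω)`. -/
def BoundedL2 {N : ℕ} {F : Type*} [NormedAddCommGroup F] (Ω : Set (Euc N))
    (u : ℕ → Euc N → F) : Prop :=
  (∀ n, MemLp (u n) 2 (volume.restrict Ω)) ∧
    ∃ C : ℝ≥0, ∀ n, eLpNorm (u n) 2 (volume.restrict Ω) ≤ C

/-- `d` is the divergence of `u` in the sense of distributions in `Ω`, with respect to the three
coordinates `σ 0, σ 1, σ 2` of `ℝ^N`. -/
def IsWeakDiv {N : ℕ} (σ : Fin 3 → Fin N) (Ω : Set (Euc N)) (u : Euc N → Fin 3 → ℂ)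
    (d : Euc N → ℂ) : Prop :=
  ∀ φ : Euc N → ℂ, ContDiff ℝ (⊤ : ℕ∞) φ → HasCompactSupport φ → tsupport φ ⊆ Ω →
    ∫ x in Ω, ∑ j, u x j * fderiv ℝ φ x (EuclideanSpace.single (σ j) 1) =
      -∫ x in Ω, d x * φ x

/-- The distributional divergences of `u_n` are functions that form a bounded sequence in
`L²(Ω)`. -/
def BoundedDiv {N : ℕ} (σ : Fin 3 → Fin N) (Ω : Set (Euc N)) (u : ℕ → Euc N → Fin 3 → ℂ) :
    Prop :=
  ∃ d : ℕ → Euc N → ℂ, BoundedL2 Ω d ∧ ∀ n, IsWeakDiv σ Ω (u n) (d n)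

/-- The space-time cylinder `(0,T) × ℝ³` in `ℝ⁴`; the coordinate `0` is the time, the coordinates
`1, 2, 3` are those of space. -/
def timeSpace (T : ℝ) : Set (Euc 4) := {z | 0 < z 0 ∧ z 0 < T}

/-- The coefficient matrix: bounded measurable, periodic with period the unit cube, hermitian and
uniformly elliptic. -/
structure IsCoefficient (P : Euc 3 → Matrix (Fin 3) (Fin 3) ℂ) : Prop where
  bounded : ∀ i j, MemLp (fun y => P y i j) ∞ volume
  periodic : ∀ (k : Fin 3) (y : Euc 3), P (y + EuclideanSpace.single k 1) = P y
  hermitian : ∀ᵐ y, (P y).IsHermitian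
  elliptic : ∃ α : ℝ, 0 < α ∧ ∀ᵐ y, ∀ η : Fin 3 → ℂ,
    α * ∑ i, ‖η i‖ ^ 2 ≤ (star η ⬝ᵥ (P y).mulVec η).re

end TwoScaleMaxwell

end

open TwoScaleMaxwell

/-!
Integrating the divergence of `u_n` against `ε_n φ(x) e^{iζ·x/ε_n}`, every term is `O(ε_n)` except
the one in which the derivative falls on the oscillating factor. Hence the limits `c_j` of the
products `e^{iζ·x/ε_n} u_{n,j}`, which are Fourier coefficients of the two-scale limit, satisfy
`∑_j ζ_j c_j = 0` for each `ζ`. A function with values in `𝓑²` has almost everywhere its spectrum in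
a fixed countable set, so the exceptional null set can be chosen independently of `ζ`.

For `P E⁰_n` one needs in addition that `P(x/ε_n) E⁰_n` two-scale converges to `P Ê⁰`. The entries
of `P` are bounded and, being periodic, Besicovitch almost periodic; they are approximated by
trigonometric polynomials in quadratic mean, which suffices because `E⁰_n` is bounded in `L²`.
-/

noncomputable section

open BoundedContinuousFunction (innerProbChar)
open scoped ProbabilityTheory

namespace TwoScaleMaxwell

lemma tendsto_of_tendsto_limsup_edist {ι κ X : Type*} [PseudoEMetricSpace X] {l : Filter ι}
    {l' : Filter κ} [l'.NeBot] {u : ι → X} {v : κ → ι → X} {a : X} {b : κ → X}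
    (hv : ∀ k, Tendsto (v k) l (𝓝 (b k))) (hb : Tendsto b l' (𝓝 a))
    (huv : Tendsto (fun k => limsup (fun n => edist (u n) (v k n)) l) l' (𝓝 0)) :
    Tendsto u l (𝓝 a) := by
  refine EMetric.tendsto_nhds.2 fun η hη => ?_
  have hη3 : 0 < η / 3 := ENNReal.div_pos hη.ne' (by simp)
  obtain ⟨k, hk, hka⟩ :=
    ((huv.eventually_lt_const hη3).and (EMetric.tendsto_nhds.1 hb _ hη3)).exists
  filter_upwards [eventually_lt_of_limsup_lt hk, EMetric.tendsto_nhds.1 (hv k) _ hη3] with n h₁ h₂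
  calc edist (u n) a ≤ edist (u n) (v k n) + edist (v k n) (b k) + edist (b k) a :=
        edist_triangle4 _ _ _ _
    _ < η / 3 + η / 3 + η / 3 := ENNReal.add_lt_add (ENNReal.add_lt_add h₁ h₂) hka
    _ = η := ENNReal.add_thirds η

lemma enorm_integral_mul_le {α 𝕜 : Type*} [RCLike 𝕜] {_ : MeasurableSpace α} {μ : Measure α}
    {f g : α → 𝕜} (hf : AEStronglyMeasurable f μ) (hg : AEStronglyMeasurable g μ) :
    ‖∫ x, f x * g x ∂μ‖ₑ ≤ eLpNorm f 2 μ * eLpNorm g 2 μ :=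
  calc ‖∫ x, f x * g x ∂μ‖ₑ ≤ ∫⁻ x, ‖f x * g x‖ₑ ∂μ := enorm_integral_le_lintegral_enorm _
    _ = eLpNorm (f • g) 1 μ := eLpNorm_one_eq_lintegral_enorm.symm
    _ ≤ eLpNorm f 2 μ * eLpNorm g 2 μ := eLpNorm_smul_le_mul_eLpNorm hg hf

lemma enorm_integral_mul_mul_le {α 𝕜 : Type*} [RCLike 𝕜] {_ : MeasurableSpace α} {μ : Measure α}
    {f g φ : α → 𝕜} {s : Set α} (hf : AEStronglyMeasurable f μ) (hg : AEStronglyMeasurable g μ)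
    (hφ : AEStronglyMeasurable φ μ) (hφs : Function.support φ ⊆ s) :
    ‖∫ x, f x * g x * φ x ∂μ‖ₑ ≤
      eLpNorm φ ∞ μ * eLpNorm g 2 μ * eLpNorm f 2 (μ.restrict s) :=
  calc ‖∫ x, f x * g x * φ x ∂μ‖ₑ = ‖∫ x, (φ • f) x * g x ∂μ‖ₑ := by
        simp only [Pi.smul_apply', smul_eq_mul, mul_comm (φ _), mul_right_comm]
    _ ≤ eLpNorm (φ • f) 2 μ * eLpNorm g 2 μ := enorm_integral_mul_le (hφ.smul hf) hg
    _ = eLpNorm (φ • f) 2 (μ.restrict s) * eLpNorm g 2 μ := by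
        rw [eLpNorm_restrict_eq_of_support_subset
          ((Function.support_smul_subset_left φ f).trans hφs)]
    _ ≤ eLpNorm φ ∞ μ * eLpNorm f 2 (μ.restrict s) * eLpNorm g 2 μ := by
        gcongr
        refine (eLpNorm_smul_le_eLpNorm_top_mul_eLpNorm 2 hf.restrict φ).trans ?_
        gcongr
        exact Measure.restrict_le_self
    _ = _ := mul_right_comm _ _ _

lemma enorm_integral_le_eLpNorm {α E : Type*} [NormedAddCommGroup E] [NormedSpace ℝ E]
    {_ : MeasurableSpace α} {μ : Measure α} [IsProbabilityMeasure μ] {f : α → E} {p : ℝ≥0∞}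
    (hp : 1 ≤ p) (hf : AEStronglyMeasurable f μ) : ‖∫ x, f x ∂μ‖ₑ ≤ eLpNorm f p μ :=
  calc ‖∫ x, f x ∂μ‖ₑ ≤ ∫⁻ x, ‖f x‖ₑ ∂μ := enorm_integral_le_lintegral_enorm _
    _ = eLpNorm f 1 μ := eLpNorm_one_eq_lintegral_enorm.symm
    _ ≤ eLpNorm f p μ := eLpNorm_le_eLpNorm_of_exponent_le hp hf

lemma setAverage_eq_integral_cond {α E : Type*} [NormedAddCommGroup E] [NormedSpace ℝ E]
    {_ : MeasurableSpace α} (μ : Measure α) (s : Set α) (f : α → E) :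
    ⨍ x in s, f x ∂μ = ∫ x, f x ∂μ[|s] := by
  rw [average, Measure.restrict_apply_univ, ProbabilityTheory.cond]

variable {N : ℕ}

/-! ### Locally square integrable functions and the Besicovitch seminorm -/

/-- The space `L²_loc(ℝ^N)`. -/
def LocL2 (u : Euc N → ℂ) : Prop := ∀ K : Set (Euc N), IsCompact K → MemLp u 2 (volume.restrict K)

/-- The seminorm of `𝓑²(ℝ^N)`, for arbitrary functions and with values in `[0, ∞]`. -/
def besNorm (u : Euc N → ℂ) : ℝ≥0∞ := upperMeanSq u ^ (1 / 2 : ℝ)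

lemma besNorm_eq_limsup (u : Euc N → ℂ) :
    besNorm u = limsup (fun n : ℕ => eLpNorm u 2 volume[|Metric.ball 0 n]) atTop :=
  upperMeanSq_rpow u

namespace LocL2

variable {u v : Euc N → ℂ}

lemma sub (hu : LocL2 u) (hv : LocL2 v) : LocL2 (u - v) := fun K hK => (hu K hK).sub (hv K hK)

lemma bdd_mul (hv : LocL2 v) (hu : MemLp u ∞) : LocL2 (u * v) := fun K hK =>
  (hv K hK).mul (hu.restrict K)

lemma aestronglyMeasurable (hu : LocL2 u) : AEStronglyMeasurable u := by
  rw [← Measure.restrict_univ (μ := volume), ← Metric.iUnion_closedBall_nat 0]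
  exact .iUnion fun n => (hu _ (isCompact_closedBall 0 n)).aestronglyMeasurable

lemma locallyIntegrable (hu : LocL2 u) : LocallyIntegrable u :=
  locallyIntegrable_iff.2 fun K hK =>
    have : IsFiniteMeasure (volume.restrict K) := isFiniteMeasure_restrict.2 hK.measure_ne_top
    (hu K hK).integrable one_le_two

end LocL2

lemma locL2_bcf (p : Euc N →ᵇ ℂ) : LocL2 p := trig_locL2 p

lemma memLp_top_bcf (p : Euc N →ᵇ ℂ) : MemLp p ∞ volume :=
  memLp_top_of_bound p.continuous.aestronglyMeasurable ‖p‖ (.of_forall p.norm_coe_le_norm)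

lemma aestronglyMeasurable_cond {u : Euc N → ℂ} (hu : AEStronglyMeasurable u) (s : Set (Euc N)) :
    AEStronglyMeasurable u volume[|s] :=
  hu.mono_ac ProbabilityTheory.cond_absolutelyContinuous

lemma besNorm_add_le {u v : Euc N → ℂ} (hu : LocL2 u) (hv : LocL2 v) :
    besNorm (u + v) ≤ besNorm u + besNorm v := upperMeanSq_add_rpow_le hu hv

lemma besNorm_sub_comm (u v : Euc N → ℂ) : besNorm (u - v) = besNorm (v - u) := by
  have h := upperMeanSq_smul_rpow (-1) (v - u)
  simpa [besNorm] using h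

lemma besNorm_sub_le {u v w : Euc N → ℂ} (hu : LocL2 u) (hv : LocL2 v) (hw : LocL2 w) :
    besNorm (u - w) ≤ besNorm (u - v) + besNorm (v - w) := by
  simpa using besNorm_add_le (hu.sub hv) (hv.sub hw)

lemma besNorm_mul_le {u v : Euc N → ℂ} (hu : MemLp u ∞) (hv : AEStronglyMeasurable v) :
    besNorm (u * v) ≤ eLpNorm u ∞ volume * besNorm v := by
  rw [besNorm_eq_limsup, besNorm_eq_limsup, ← ENNReal.limsup_const_mul_of_ne_top hu.2.ne]
  refine limsup_le_limsup (.of_forall fun n => ?_)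
  have hac : volume[|Metric.ball (0 : Euc N) n] ≪ volume :=
    ProbabilityTheory.cond_absolutelyContinuous
  have htop : eLpNorm u ∞ volume[|Metric.ball (0 : Euc N) n] ≤ eLpNorm u ∞ volume := by
    simpa only [eLpNorm_exponent_top] using eLpNormEssSup_mono_measure u hac
  calc eLpNorm (u • v) 2 volume[|Metric.ball 0 n]
      ≤ eLpNorm u ∞ volume[|Metric.ball 0 n] * eLpNorm v 2 volume[|Metric.ball 0 n] :=
        eLpNorm_smul_le_mul_eLpNorm (hv.mono_ac hac) (hu.1.mono_ac hac)
    _ ≤ eLpNorm u ∞ volume * eLpNorm v 2 volume[|Metric.ball 0 n] :=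
        mul_le_mul_left htop _

namespace IsBesicovitch

variable {u : Euc N → ℂ}

lemma besNorm_ne_top (hu : IsBesicovitch u) : besNorm u ≠ ∞ := hu.upperMeanSq_lt_top.ne

lemma exists_seq_trig (hu : IsBesicovitch u) : ∃ p : ℕ → Euc N →ᵇ ℂ,
    (∀ k, p k ∈ trig N) ∧ Tendsto (fun k => besNorm (u - ⇑(p k))) atTop (𝓝 0) := by
  choose p hp hup using fun k : ℕ =>
    hu.approx_rpow (k : ℝ≥0∞)⁻¹ (ENNReal.inv_pos.2 (ENNReal.natCast_ne_top k))
  exact ⟨p, hp, tendsto_of_tendsto_of_tendsto_of_le_of_le tendsto_const_nhds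
    ENNReal.tendsto_inv_nat_nhds_zero (fun _ => zero_le) fun k => (hup k).le⟩

lemma of_tendsto {κ : Type*} {l : Filter κ} [l.NeBot] {v : κ → Euc N → ℂ} (hu : LocL2 u)
    (hv : ∀ k, IsBesicovitch (v k)) (huv : Tendsto (fun k => besNorm (u - v k)) l (𝓝 0)) :
    IsBesicovitch u := by
  refine .of_rpow hu fun η hη => ?_
  obtain ⟨k, hk⟩ := (huv.eventually_lt_const (ENNReal.half_pos hη.ne')).exists
  obtain ⟨p, hp, hkp⟩ := (hv k).approx_rpow _ (ENNReal.half_pos hη.ne')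
  refine ⟨p, hp, ?_⟩
  calc besNorm (u - ⇑p) ≤ besNorm (u - v k) + besNorm (v k - ⇑p) :=
        besNorm_sub_le hu (hv k).locL2 (locL2_bcf p)
    _ < η / 2 + η / 2 := ENNReal.add_lt_add hk hkp
    _ = η := ENNReal.add_halves η

end IsBesicovitch

/-! ### Oscillating functions on bounded sets -/

lemma map_smul_cond {E : Type*} [NormedAddCommGroup E] [NormedSpace ℝ E] [FiniteDimensional ℝ E]
    [MeasurableSpace E] [BorelSpace E] (μ : Measure E) [μ.IsAddHaarMeasure] (s : Set E) {c : ℝ}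
    (hc : c ≠ 0) : μ[|s].map (c • ·) = μ[|c • s] := by
  have hd : 0 < |c ^ Module.finrank ℝ E| := abs_pos.2 (pow_ne_zero _ hc)
  have hmap : (μ.restrict s).map (c • ·) =
      (ENNReal.ofReal |c ^ Module.finrank ℝ E|)⁻¹ • μ.restrict (c • s) := by
    have h := (measurableEmbedding_const_smul₀ hc).restrict_map μ (c • s)
    rwa [preimage_smul₀ hc, inv_smul_smul₀ hc, Measure.map_addHaar_smul μ hc,
      Measure.restrict_smul, abs_inv, ENNReal.ofReal_inv_of_pos hd, eq_comm] at h
  rw [ProbabilityTheory.cond, ProbabilityTheory.cond, Measure.map_smul, hmap, smul_smul,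
    Measure.addHaar_smul, mul_comm, ENNReal.mul_inv (.inl (by simpa using hd.ne'))
      (.inl ENNReal.ofReal_ne_top)]

lemma setAverage_smul_set {E F : Type*} [NormedAddCommGroup E] [NormedSpace ℝ E]
    [FiniteDimensional ℝ E] [MeasurableSpace E] [BorelSpace E] (μ : Measure E)
    [μ.IsAddHaarMeasure] [NormedAddCommGroup F] [NormedSpace ℝ F] (f : E → F) (s : Set E) {c : ℝ}
    (hc : c ≠ 0) : ⨍ y in c • s, f y ∂μ = ⨍ x in s, f (c • x) ∂μ := by
  rw [setAverage_eq_integral_cond, setAverage_eq_integral_cond, ← map_smul_cond μ s hc,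
    (measurableEmbedding_const_smul₀ hc).integral_map]

lemma eLpNorm_restrict_eq_cond {α F : Type*} [NormedAddCommGroup F] {_ : MeasurableSpace α}
    {μ : Measure α} {s : Set α} (h0 : μ s ≠ 0) (htop : μ s ≠ ∞) (f : α → F) :
    eLpNorm f 2 (μ.restrict s) = μ s ^ (1 / 2 : ℝ) * eLpNorm f 2 μ[|s] := by
  have h := eLpNorm_smul_measure_of_ne_top (μ := μ[|s]) ENNReal.ofNat_ne_top f (μ s) (p := 2)
  rwa [ProbabilityTheory.cond, smul_smul, ENNReal.mul_inv_cancel h0 htop, one_smul,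
    ENNReal.toReal_div, ENNReal.toReal_one, ENNReal.toReal_ofNat, smul_eq_mul] at h

lemma eLpNorm_comp_inv_smul_le {e : ℝ} (he : 0 < e) {k : ℕ} (hk : k ≠ 0)
    {s : Set (Euc N)} (hs : s ⊆ Metric.ball 0 (e * k)) (w : Euc N → ℂ) :
    eLpNorm (fun x => w (e⁻¹ • x)) 2 (volume.restrict s) ≤
      volume (Metric.ball (0 : Euc N) (e * k)) ^ (1 / 2 : ℝ) *
        eLpNorm w 2 volume[|Metric.ball 0 k] := by
  have hpos : volume (Metric.ball (0 : Euc N) (e * k)) ≠ 0 :=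
    (Metric.measure_ball_pos volume _ (by positivity)).ne'
  have hball : e⁻¹ • Metric.ball (0 : Euc N) (e * k) = Metric.ball 0 k := by
    rw [smul_ball (inv_ne_zero he.ne'), smul_zero, norm_inv, Real.norm_of_nonneg he.le,
      inv_mul_cancel_left₀ he.ne']
  calc eLpNorm (fun x => w (e⁻¹ • x)) 2 (volume.restrict s)
      ≤ eLpNorm (fun x => w (e⁻¹ • x)) 2 (volume.restrict (Metric.ball 0 (e * k))) :=
        eLpNorm_mono_measure _ (Measure.restrict_mono hs le_rfl)
    _ = volume (Metric.ball (0 : Euc N) (e * k)) ^ (1 / 2 : ℝ) *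
          eLpNorm (w ∘ (e⁻¹ • ·)) 2 volume[|Metric.ball (0 : Euc N) (e * k)] :=
        eLpNorm_restrict_eq_cond hpos measure_ball_lt_top.ne _
    _ = _ := by
        rw [← (measurableEmbedding_const_smul₀ (inv_ne_zero he.ne')).eLpNorm_map_measure,
          map_smul_cond volume _ (inv_ne_zero he.ne'), hball]

lemma limsup_eLpNorm_comp_inv_smul_le {ι : Type*} {l : Filter ι} {ε : ι → ℝ}
    (hε : Tendsto ε l (𝓝[>] 0)) {s : Set (Euc N)} {R : ℝ} (hR : 0 < R)
    (hs : s ⊆ Metric.ball 0 R) (w : Euc N → ℂ) :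
    limsup (fun n => eLpNorm (fun x => w ((ε n)⁻¹ • x)) 2 (volume.restrict s)) l ≤
      volume (Metric.ball (0 : Euc N) (R + 1)) ^ (1 / 2 : ℝ) * besNorm w := by
  set C := volume (Metric.ball (0 : Euc N) (R + 1)) ^ (1 / 2 : ℝ)
  have hC : C ≠ ∞ := ENNReal.rpow_ne_top_of_nonneg (by norm_num) measure_ball_lt_top.ne
  have hk : Tendsto (fun n => ⌈R / ε n⌉₊) l atTop :=
    tendsto_nat_ceil_atTop.comp ((tendsto_inv_nhdsGT_zero.comp hε).const_mul_atTop hR)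
  have hle : ∀ᶠ n in l, eLpNorm (fun x => w ((ε n)⁻¹ • x)) 2 (volume.restrict s) ≤
      C * eLpNorm w 2 volume[|Metric.ball 0 (⌈R / ε n⌉₊ : ℕ)] := by
    filter_upwards [hε self_mem_nhdsWithin, hk.eventually (eventually_ne_atTop 0),
      (tendsto_nhds_of_tendsto_nhdsWithin hε).eventually_lt_const one_pos] with n hpos hne hlt
    rw [mem_preimage, mem_Ioi] at hpos
    have hRk : R ≤ ε n * ⌈R / ε n⌉₊ := (div_le_iff₀' hpos).1 (Nat.le_ceil _)
    refine (eLpNorm_comp_inv_smul_le hpos hne (hs.trans (Metric.ball_subset_ball hRk)) w).trans ?_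
    refine mul_le_mul_left (ENNReal.rpow_le_rpow (measure_mono (Metric.ball_subset_ball ?_))
      (by norm_num)) _
    calc ε n * ⌈R / ε n⌉₊ ≤ ε n * (R / ε n + 1) := by
          gcongr
          exact (Nat.ceil_lt_add_one (by positivity)).le
      _ = R + ε n := by field_simp
      _ ≤ R + 1 := by gcongr
  calc _ ≤ limsup (fun n => C * eLpNorm w 2 volume[|Metric.ball 0 (⌈R / ε n⌉₊ : ℕ)]) l :=
        limsup_le_limsup hle
    _ = C * limsup (fun n => eLpNorm w 2 volume[|Metric.ball 0 (⌈R / ε n⌉₊ : ℕ)]) l :=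
        ENNReal.limsup_const_mul_of_ne_top hC
    _ ≤ C * besNorm w := by
        rw [besNorm_eq_limsup]
        gcongr
        exact hk.limsup_comp_le_limsup (u := fun k : ℕ => eLpNorm w 2 volume[|Metric.ball 0 k])

/-! ### Mean values -/

lemma exists_limsup_enorm_setAverage_smul_le {s : Set (Euc N)} (hs : Bornology.IsBounded s)
    (h0 : volume s ≠ 0) : ∃ C : ℝ≥0∞, C ≠ ∞ ∧ ∀ u : Euc N → ℂ, AEStronglyMeasurable u →
      limsup (fun n : ℕ => ‖⨍ y in (n : ℝ) • s, u y‖ₑ) atTop ≤ C * besNorm u := by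
  obtain ⟨R, hR, hsR⟩ := hs.subset_ball_lt 0 0
  have hcond : IsProbabilityMeasure (volume[|s]) :=
    ProbabilityTheory.cond_isProbabilityMeasure_of_finite h0 hs.measure_lt_top.ne
  set D := (volume s)⁻¹ ^ (1 / 2 : ℝ)
  have hD : D ≠ ∞ := ENNReal.rpow_ne_top_of_nonneg (by norm_num) (ENNReal.inv_ne_top.2 h0)
  set C := volume (Metric.ball (0 : Euc N) (R + 1)) ^ (1 / 2 : ℝ)
  have hC : C ≠ ∞ := ENNReal.rpow_ne_top_of_nonneg (by norm_num) measure_ball_lt_top.ne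
  refine ⟨D * C, ENNReal.mul_ne_top hD hC, fun u hu => ?_⟩
  have hn : ∀ᶠ n : ℕ in atTop, ‖⨍ y in (n : ℝ) • s, u y‖ₑ ≤
      D * eLpNorm (fun x => u (((n : ℝ)⁻¹)⁻¹ • x)) 2 (volume.restrict s) := by
    filter_upwards [eventually_ne_atTop 0] with n hn
    have hn' : (n : ℝ) ≠ 0 := Nat.cast_ne_zero.2 hn
    have hmeas : AEStronglyMeasurable (fun x => u ((n : ℝ) • x)) :=
      hu.comp_quasiMeasurePreserving (Measure.quasiMeasurePreserving_smul volume hn')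
    rw [setAverage_smul_set volume u s hn', setAverage_eq_integral_cond, inv_inv]
    refine (enorm_integral_le_eLpNorm one_le_two (aestronglyMeasurable_cond hmeas s)).trans_eq ?_
    rw [ProbabilityTheory.cond, eLpNorm_smul_measure_of_ne_top ENNReal.ofNat_ne_top]
    simp [D]
  calc _ ≤ limsup (fun n : ℕ =>
          D * eLpNorm (fun x => u (((n : ℝ)⁻¹)⁻¹ • x)) 2 (volume.restrict s)) atTop :=
        limsup_le_limsup hn
    _ ≤ D * (C * besNorm u) := by
        rw [ENNReal.limsup_const_mul_of_ne_top hD]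
        gcongr
        exact limsup_eLpNorm_comp_inv_smul_le
          (tendsto_inv_atTop_nhdsGT_zero.comp tendsto_natCast_atTop_atTop) hR hsR u
    _ = D * C * besNorm u := (mul_assoc _ _ _).symm

lemma integrableOn_of_isBounded {u : Euc N → ℂ} (hu : LocallyIntegrable u) {s : Set (Euc N)}
    (hs : Bornology.IsBounded s) : IntegrableOn u s :=
  (hu.integrableOn_isCompact hs.isCompact_closure).mono_set subset_closure

lemma setAverage_add {u v : Euc N → ℂ} (hu : LocallyIntegrable u) (hv : LocallyIntegrable v)
    {s : Set (Euc N)} (hs : Bornology.IsBounded s) :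
    ⨍ y in s, (u + v) y = (⨍ y in s, u y) + ⨍ y in s, v y := by
  simp only [setAverage_eq, Pi.add_apply, integral_add (integrableOn_of_isBounded hu hs)
    (integrableOn_of_isBounded hv hs), smul_add]

lemma setAverage_sub {u v : Euc N → ℂ} (hu : LocallyIntegrable u) (hv : LocallyIntegrable v)
    {s : Set (Euc N)} (hs : Bornology.IsBounded s) :
    ⨍ y in s, (u - v) y = (⨍ y in s, u y) - ⨍ y in s, v y := by
  simp only [setAverage_eq, Pi.sub_apply, integral_sub (integrableOn_of_isBounded hu hs)
    (integrableOn_of_isBounded hv hs), smul_sub]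

lemma enorm_setAverage_le_eLpNorm_cond {u : Euc N → ℂ} (hu : AEStronglyMeasurable u)
    {s : Set (Euc N)} (h0 : volume s ≠ 0) (htop : volume s ≠ ∞) :
    ‖⨍ y in s, u y‖ₑ ≤ eLpNorm u 2 volume[|s] := by
  have := ProbabilityTheory.cond_isProbabilityMeasure_of_finite h0 htop
  rw [setAverage_eq_integral_cond]
  exact enorm_integral_le_eLpNorm one_le_two (aestronglyMeasurable_cond hu s)

namespace HasMeanValue

variable {u v : Euc N → ℂ} {m m' : ℂ}

lemma tendsto_ball (h : HasMeanValue u m) :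
    Tendsto (fun n : ℕ => ⨍ y in Metric.ball 0 n, u y) atTop (𝓝 m) := by
  have hpos := (Metric.measure_ball_pos volume (0 : Euc N) one_pos).ne'
  refine (h.tendsto _ Metric.isBounded_ball measurableSet_ball hpos).congr' ?_
  filter_upwards [eventually_ne_atTop 0] with n hn
  rw [smul_unitBall (Nat.cast_ne_zero.2 hn), Real.norm_natCast]

lemma unique (h : HasMeanValue u m) (h' : HasMeanValue u m') : m = m' :=
  tendsto_nhds_unique h.tendsto_ball h'.tendsto_ball

lemma meanValue_eq (h : HasMeanValue u m) : meanValue u = m := by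
  have hex : ∃ m, HasMeanValue u m := ⟨m, h⟩
  rw [meanValue, dif_pos hex]
  exact hex.choose_spec.unique h

lemma add (h : HasMeanValue u m) (h' : HasMeanValue v m') : HasMeanValue (u + v) (m + m') :=
  ⟨h.locInt.add h'.locInt, fun ω hb hm h0 =>
    ((h.tendsto ω hb hm h0).add (h'.tendsto ω hb hm h0)).congr fun _ =>
      (setAverage_add h.locInt h'.locInt (hb.smul₀ _)).symm⟩

lemma sub (h : HasMeanValue u m) (h' : HasMeanValue v m') : HasMeanValue (u - v) (m - m') :=
  ⟨h.locInt.sub h'.locInt, fun ω hb hm h0 =>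
    ((h.tendsto ω hb hm h0).sub (h'.tendsto ω hb hm h0)).congr fun _ =>
      (setAverage_sub h.locInt h'.locInt (hb.smul₀ _)).symm⟩

lemma smul (c : ℂ) (h : HasMeanValue u m) : HasMeanValue (c • u) (c * m) := by
  refine ⟨h.locInt.smul c, fun ω hb hm h0 => ((h.tendsto ω hb hm h0).const_mul c).congr fun n => ?_⟩
  simp only [setAverage_eq, Pi.smul_apply, smul_eq_mul, integral_const_mul, mul_smul_comm]

lemma enorm_le_limsup (h : HasMeanValue u m) {a : ℕ → ℝ≥0∞}
    (ha : ∀ n : ℕ, n ≠ 0 → ‖⨍ y in Metric.ball (0 : Euc N) n, u y‖ₑ ≤ a n) :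
    ‖m‖ₑ ≤ limsup a atTop := by
  rw [← h.tendsto_ball.enorm.limsup_eq]
  exact limsup_le_limsup ((eventually_ne_atTop 0).mono ha)

lemma enorm_le (h : HasMeanValue u m) (hu : AEStronglyMeasurable u) : ‖m‖ₑ ≤ besNorm u := by
  rw [besNorm_eq_limsup]
  refine h.enorm_le_limsup fun n hn => enorm_setAverage_le_eLpNorm_cond hu ?_ measure_ball_lt_top.ne
  exact (Metric.measure_ball_pos volume _ (by positivity)).ne'

lemma enorm_mul_le (h : HasMeanValue (u * v) m) (hu : AEStronglyMeasurable u)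
    (hv : AEStronglyMeasurable v) (hu' : besNorm u ≠ ∞) (hv' : besNorm v ≠ ∞) :
    ‖m‖ₑ ≤ besNorm u * besNorm v := by
  rw [besNorm_eq_limsup] at hu' hv'
  rw [besNorm_eq_limsup, besNorm_eq_limsup]
  refine (h.enorm_le_limsup fun n _ => ?_).trans (ENNReal.limsup_mul_le' (.inr hv') (.inl hu'))
  rw [setAverage_eq_integral_cond]
  exact enorm_integral_mul_le (aestronglyMeasurable_cond hu _) (aestronglyMeasurable_cond hv _)

end HasMeanValue

lemma innerProbChar_mem_trig (ξ : Euc N) : innerProbChar ξ ∈ trig N :=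
  Submodule.subset_span ⟨ξ, rfl⟩

lemma innerProbChar_smul_right {E : Type*} [NormedAddCommGroup E] [InnerProductSpace ℝ E]
    (ξ x : E) (c : ℝ) : innerProbChar ξ (c • x) = innerProbChar (c • ξ) x := by
  simp only [BoundedContinuousFunction.innerProbChar_apply, inner_smul_left, inner_smul_right]
  simp

lemma innerProbChar_mul {E : Type*} [NormedAddCommGroup E] [InnerProductSpace ℝ E] (ξ η : E) :
    innerProbChar ξ * innerProbChar η = innerProbChar (ξ + η) := by
  ext y
  simp only [BoundedContinuousFunction.mul_apply, BoundedContinuousFunction.innerProbChar_apply,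
    inner_add_right, ← Complex.exp_add, Complex.ofReal_add, add_mul]

lemma tendsto_setIntegral_innerProbChar {E : Type*} [NormedAddCommGroup E] [InnerProductSpace ℝ E]
    [FiniteDimensional ℝ E] [MeasurableSpace E] [BorelSpace E] {s : Set E} (hs : MeasurableSet s) :
    Tendsto (fun ξ => ∫ x in s, innerProbChar ξ x) (cocompact E) (𝓝 0) := by
  have hRL := tendsto_integral_exp_inner_smul_cocompact (s.indicator fun _ : E => (1 : ℂ))
  have hpi : -(2 * Real.pi)⁻¹ ≠ 0 := by simp [Real.pi_ne_zero]
  refine (hRL.comp (Homeomorph.smulOfNeZero _ hpi).isClosedEmbedding.tendsto_cocompact).congr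
    fun ξ => ?_
  rw [← integral_indicator hs]
  refine integral_congr_ae (.of_forall fun x => ?_)
  by_cases hx : x ∈ s
  · simp only [indicator_of_mem hx, Circle.smul_def, Real.fourierChar_apply,
      smul_eq_mul, mul_one, BoundedContinuousFunction.innerProbChar_apply]
    simp [inner_smul_right]
    field_simp
  · simp [hx]

lemma hasMeanValue_innerProbChar (ξ : Euc N) :
    HasMeanValue (innerProbChar ξ) (if ξ = 0 then 1 else 0) := by
  refine ⟨(locL2_bcf _).locallyIntegrable, fun ω hb hm h0 => ?_⟩
  have hdil : ∀ᶠ n : ℕ in atTop,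
      ⨍ x in ω, innerProbChar ((n : ℝ) • ξ) x = ⨍ y in (n : ℝ) • ω, innerProbChar ξ y := by
    filter_upwards [eventually_ne_atTop 0] with n hn
    rw [setAverage_smul_set volume _ ω (Nat.cast_ne_zero.2 hn)]
    simp only [innerProbChar_smul_right]
  refine Tendsto.congr' hdil ?_
  split_ifs with hξ
  · simp only [hξ, smul_zero, BoundedContinuousFunction.innerProbChar_zero,
      BoundedContinuousFunction.coe_one, Pi.one_apply, setAverage_const h0 hb.measure_lt_top.ne]
    exact tendsto_const_nhds
  · have hn : Tendsto (fun n : ℕ => (n : ℝ) • ξ) atTop (cocompact (Euc N)) := by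
      rw [← Metric.cobounded_eq_cocompact, ← tendsto_norm_atTop_iff_cobounded]
      simp only [norm_smul, Real.norm_natCast]
      exact tendsto_natCast_atTop_atTop.atTop_mul_const (norm_pos_iff.2 hξ)
    simp only [setAverage_eq]
    simpa using ((tendsto_setIntegral_innerProbChar hm).comp hn).const_smul (volume.real ω)⁻¹

lemma exists_hasMeanValue_trig {p : Euc N →ᵇ ℂ} (hp : p ∈ trig N) : ∃ m, HasMeanValue p m := by
  induction hp using Submodule.span_induction with
  | mem x hx =>
    obtain ⟨ξ, rfl⟩ := hx
    exact ⟨_, hasMeanValue_innerProbChar ξ⟩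
  | zero => exact ⟨_, by simpa using (hasMeanValue_innerProbChar (0 : Euc N)).smul 0⟩
  | add p q _ _ hp hq =>
    obtain ⟨m, hm⟩ := hp
    obtain ⟨m', hm'⟩ := hq
    exact ⟨m + m', hm.add hm'⟩
  | smul c p _ hp =>
    obtain ⟨m, hm⟩ := hp
    exact ⟨c * m, hm.smul c⟩

lemma cauchySeq_of_hasMeanValue {u : Euc N → ℂ} (hu : LocL2 u) {v : ℕ → Euc N → ℂ}
    (hv : ∀ k, LocL2 (v k)) (huv : Tendsto (fun k => besNorm (u - v k)) atTop (𝓝 0))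
    {m : ℕ → ℂ} (hm : ∀ k, HasMeanValue (v k) (m k)) : CauchySeq m := by
  refine EMetric.cauchySeq_iff.2 fun η hη => ?_
  obtain ⟨K, hK⟩ := eventually_atTop.1 (huv.eventually_lt_const (ENNReal.half_pos hη.ne'))
  refine ⟨K, fun j hj k hk => ?_⟩
  calc edist (m j) (m k) = ‖m j - m k‖ₑ := edist_eq_enorm_sub _ _
    _ ≤ besNorm (v j - v k) :=
        ((hm j).sub (hm k)).enorm_le ((hv j).sub (hv k)).aestronglyMeasurable
    _ ≤ besNorm (u - v j) + besNorm (u - v k) := by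
        rw [besNorm_sub_comm u]
        exact besNorm_sub_le (hv j) hu (hv k)
    _ < η / 2 + η / 2 := ENNReal.add_lt_add (hK j hj) (hK k hk)
    _ = η := ENNReal.add_halves η

lemma HasMeanValue.of_tendsto {u : Euc N → ℂ} (hu : LocL2 u) {v : ℕ → Euc N → ℂ}
    (hv : ∀ k, LocL2 (v k)) (huv : Tendsto (fun k => besNorm (u - v k)) atTop (𝓝 0))
    {m : ℕ → ℂ} (hm : ∀ k, HasMeanValue (v k) (m k)) {a : ℂ} (ha : Tendsto m atTop (𝓝 a)) :
    HasMeanValue u a := by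
  refine ⟨hu.locallyIntegrable, fun ω hb hω h0 => ?_⟩
  obtain ⟨C, hC, hle⟩ := exists_limsup_enorm_setAverage_smul_le hb h0
  refine tendsto_of_tendsto_limsup_edist (fun k => (hm k).tendsto ω hb hω h0) ha ?_
  have hlim : Tendsto (fun k => C * besNorm (u - v k)) atTop (𝓝 0) := by
    simpa using ENNReal.Tendsto.const_mul huv (.inr hC)
  refine tendsto_of_tendsto_of_tendsto_of_le_of_le tendsto_const_nhds hlim (fun _ => zero_le)
    fun k => ?_
  simp only [edist_eq_enorm_sub, ← setAverage_sub hu.locallyIntegrable (hm k).locInt (hb.smul₀ _)]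
  exact hle _ (hu.sub (hv k)).aestronglyMeasurable

lemma IsBesicovitch.hasMeanValue {u : Euc N → ℂ} (hu : IsBesicovitch u) :
    HasMeanValue u (meanValue u) := by
  obtain ⟨p, hp, hup⟩ := hu.exists_seq_trig
  choose m hm using fun k => exists_hasMeanValue_trig (hp k)
  obtain ⟨a, ha⟩ := cauchySeq_tendsto_of_complete
    (cauchySeq_of_hasMeanValue hu.locL2 (fun k => locL2_bcf (p k)) hup hm)
  have h := HasMeanValue.of_tendsto hu.locL2 (fun k => locL2_bcf (p k)) hup hm ha
  rwa [h.meanValue_eq]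

/-! ### Multiplication operators and Fourier coefficients -/

/-- The essentially bounded functions of `𝓑²(ℝ^N)`; multiplication by them preserves `𝓑²(ℝ^N)`. -/
structure IsMultiplier (m : Euc N → ℂ) : Prop where
  besicovitch : IsBesicovitch m
  bounded : MemLp m ∞ volume

lemma mul_mem_trig {p q : Euc N →ᵇ ℂ} (hp : p ∈ trig N) (hq : q ∈ trig N) : p * q ∈ trig N := by
  have h := Submodule.mul_mem_mul hp hq
  rw [trig, Submodule.span_mul_span] at h
  refine Submodule.span_mono ?_ h
  rintro _ ⟨_, ⟨ξ, rfl⟩, _, ⟨η, rfl⟩, rfl⟩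
  exact ⟨ξ + η, (innerProbChar_mul ξ η).symm⟩

lemma isMultiplier_of_mem_trig {p : Euc N →ᵇ ℂ} (hp : p ∈ trig N) : IsMultiplier p :=
  ⟨isBesicovitch_bdd hp, memLp_top_bcf p⟩

lemma isMultiplier_innerProbChar (ξ : Euc N) : IsMultiplier (innerProbChar ξ) :=
  isMultiplier_of_mem_trig (innerProbChar_mem_trig ξ)

lemma IsBesicovitch.mul_of_forall_trig {m u : Euc N → ℂ} (hu : IsBesicovitch u)
    (hm : MemLp m ∞ volume) (htrig : ∀ p ∈ trig N, IsBesicovitch (m * ⇑p)) :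
    IsBesicovitch (m * u) := by
  obtain ⟨p, hp, hup⟩ := hu.exists_seq_trig
  have hlocL2 : LocL2 u := hu.locL2
  have hbound (k : ℕ) :
      besNorm (m * u - m * ⇑(p k)) ≤ eLpNorm m ∞ volume * besNorm (u - ⇑(p k)) := by
    rw [← mul_sub]
    exact besNorm_mul_le hm (hlocL2.sub (locL2_bcf (p k))).aestronglyMeasurable
  refine .of_tendsto (hlocL2.bdd_mul hm) (fun k => htrig (p k) (hp k)) ?_ (l := atTop)
  refine tendsto_of_tendsto_of_tendsto_of_le_of_le tendsto_const_nhds ?_ (fun _ => zero_le) hbound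
  simpa using ENNReal.Tendsto.const_mul hup (.inr hm.2.ne)

namespace IsMultiplier

variable {m m' u : Euc N → ℂ}

lemma mul_isBesicovitch (hm : IsMultiplier m) (hu : IsBesicovitch u) : IsBesicovitch (m * u) :=
  hu.mul_of_forall_trig hm.bounded fun p hp => by
    rw [mul_comm]
    exact hm.besicovitch.mul_of_forall_trig (memLp_top_bcf p) fun q hq =>
      isBesicovitch_bdd (mul_mem_trig hp hq)

lemma mul (hm : IsMultiplier m) (hm' : IsMultiplier m') : IsMultiplier (m * m') :=
  ⟨hm.mul_isBesicovitch hm'.besicovitch, hm'.bounded.mul hm.bounded⟩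

end IsMultiplier

namespace Besicovitch

/-- `𝓑²(ℝ^N)` is a seminormed complex vector space. -/
instance : NormedSpace ℂ (Besicovitch N) := ⟨fun c u => ((core N).norm_smul c u).le⟩

/-- The element of `𝓑²(ℝ^N)` represented by `u`. -/
def of {u : Euc N → ℂ} (hu : IsBesicovitch u) : Besicovitch N := ⟨u, hu⟩

lemma coe_of {u : Euc N → ℂ} (hu : IsBesicovitch u) : ⇑(of hu) = u := rfl

lemma isBesicovitch (u : Besicovitch N) : IsBesicovitch u := u.2

lemma enorm_eq (u : Besicovitch N) : ‖u‖ₑ = besNorm u := by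
  rw [← ofReal_norm]
  exact ENNReal.ofReal_toReal u.isBesicovitch.besNorm_ne_top

lemma edist_eq (u v : Besicovitch N) : edist u v = besNorm (⇑u - ⇑v) := by
  rw [edist_eq_enorm_sub, enorm_eq]
  rfl

lemma coe_sum {ι : Type*} (s : Finset ι) (u : ι → Besicovitch N) :
    ⇑(∑ i ∈ s, u i) = ∑ i ∈ s, ⇑(u i) :=
  map_sum (besicovitchSubmodule N).subtype u s

/-- The operator on `𝓑²(ℝ^N)` of multiplication by a multiplier `m`. -/
def mulCLM {m : Euc N → ℂ} (hm : IsMultiplier m) : Besicovitch N →L[ℂ] Besicovitch N :=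
  LinearMap.mkContinuous
    { toFun := fun u => of (hm.mul_isBesicovitch u.isBesicovitch)
      map_add' := fun u v => Subtype.ext (mul_add m ⇑u ⇑v)
      map_smul' := fun c u => Subtype.ext (mul_smul_comm c m ⇑u) }
    (eLpNorm m ∞ volume).toReal fun u => by
      have hu : LocL2 u := u.isBesicovitch.locL2
      rw [← toReal_enorm, ← toReal_enorm, ← ENNReal.toReal_mul, enorm_eq, enorm_eq]
      exact ENNReal.toReal_mono
        (ENNReal.mul_ne_top hm.bounded.2.ne u.isBesicovitch.besNorm_ne_top)
        (besNorm_mul_le hm.bounded hu.aestronglyMeasurable)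

lemma coe_mulCLM {m : Euc N → ℂ} (hm : IsMultiplier m) (u : Besicovitch N) :
    ⇑(mulCLM hm u) = m * ⇑u := rfl

/-- The mean value as a continuous linear functional on `𝓑²(ℝ^N)`. -/
def meanCLM (N : ℕ) : Besicovitch N →L[ℂ] ℂ :=
  LinearMap.mkContinuous
    { toFun := fun u => meanValue u
      map_add' := fun u v =>
        (u.isBesicovitch.hasMeanValue.add v.isBesicovitch.hasMeanValue).meanValue_eq
      map_smul' := fun c u => (u.isBesicovitch.hasMeanValue.smul c).meanValue_eq }
    1 fun u => by
      have hu : LocL2 u := u.isBesicovitch.locL2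
      rw [one_mul, ← toReal_enorm, ← toReal_enorm, enorm_eq]
      exact ENNReal.toReal_mono u.isBesicovitch.besNorm_ne_top
        (u.isBesicovitch.hasMeanValue.enorm_le hu.aestronglyMeasurable)

lemma meanCLM_apply (u : Besicovitch N) : meanCLM N u = meanValue u := rfl

/-- The Fourier coefficient at the frequency `ξ` as a continuous linear functional. -/
def coeffCLM (ξ : Euc N) : Besicovitch N →L[ℂ] ℂ :=
  meanCLM N ∘L mulCLM (isMultiplier_innerProbChar (-ξ))

end Besicovitch

lemma fourierCoeff_eq_meanValue_mul (u : Euc N → ℂ) (ξ : Euc N) :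
    fourierCoeff u ξ = meanValue (⇑(innerProbChar (-ξ)) * u) := by
  rw [fourierCoeff]
  congr 1
  funext y
  rw [Pi.mul_apply, BoundedContinuousFunction.innerProbChar_apply, real_inner_comm, inner_neg_right]
  congr 2
  push_cast
  ring

namespace Besicovitch

lemma coeffCLM_apply (ξ : Euc N) (u : Besicovitch N) : coeffCLM ξ u = fourierCoeff u ξ :=
  (fourierCoeff_eq_meanValue_mul u ξ).symm

/-- The exponential `y ↦ e^{iη·y}` as an element of `𝓑²(ℝ^N)`. -/
def char (η : Euc N) : Besicovitch N :=
  of (isMultiplier_innerProbChar η).besicovitch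

lemma coeffCLM_char_of_ne {ξ η : Euc N} (h : ξ ≠ η) : coeffCLM ξ (char η) = 0 := by
  have hprod : ⇑(innerProbChar (-ξ)) * ⇑(innerProbChar η) = innerProbChar (-ξ + η) := by
    rw [← innerProbChar_mul]
    rfl
  have hmean := (hasMeanValue_innerProbChar (-ξ + η)).meanValue_eq
  rwa [if_neg (by rwa [neg_add_eq_zero]), ← hprod] at hmean

lemma of_mem_span_char {p : Euc N →ᵇ ℂ} (hp : p ∈ trig N) :
    of (isBesicovitch_bdd hp) ∈ Submodule.span ℂ (range char) := by
  induction hp using Submodule.span_induction with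
  | mem _ h => obtain ⟨η, rfl⟩ := h; exact Submodule.subset_span ⟨η, rfl⟩
  | zero => exact zero_mem _
  | add _ _ _ _ hp hq => exact add_mem hp hq
  | smul c _ _ hp => exact Submodule.smul_mem _ c hp

lemma topologicalClosure_span_char :
    (Submodule.span ℂ (range (char (N := N)))).topologicalClosure = ⊤ := by
  refine eq_top_iff.2 fun u _ => ?_
  obtain ⟨p, hp, hup⟩ := u.isBesicovitch.exists_seq_trig
  refine mem_closure_of_tendsto (f := fun k => of (isBesicovitch_bdd (hp k)))
    (b := atTop) ?_ (.of_forall fun k => of_mem_span_char (hp k))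
  refine tendsto_iff_edist_tendsto_0.2 (hup.congr fun k => ?_)
  rw [edist_comm, edist_eq, coe_of]

/-- The closed subspace of the elements with countably many nonzero Fourier coefficients. -/
def countableSpectrum (N : ℕ) : Submodule ℂ (Besicovitch N) where
  carrier := {u | {ξ | coeffCLM ξ u ≠ 0}.Countable}
  zero_mem' := by simp
  add_mem' hu hv := (hu.union hv).mono fun ξ hξ => by
    by_contra hne
    simp only [mem_union, mem_ofPred_eq, not_or, not_not] at hne
    exact hξ (by rw [map_add, hne.1, hne.2, add_zero])
  smul_mem' c u hu := by
    refine Countable.mono (fun ξ hξ => ?_) hu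
    by_contra hne
    rw [mem_ofPred_eq, not_not] at hne
    exact hξ (by rw [map_smul, hne, smul_zero])

lemma mem_countableSpectrum {u : Besicovitch N} :
    u ∈ countableSpectrum N ↔ {ξ | coeffCLM ξ u ≠ 0}.Countable := Iff.rfl

lemma isClosed_countableSpectrum : IsClosed (countableSpectrum N : Set (Besicovitch N)) := by
  refine IsSeqClosed.isClosed fun u v hu huv => ?_
  refine (countable_iUnion fun k => mem_countableSpectrum.1 (hu k)).mono fun ξ hξ => ?_
  by_contra hne
  simp only [mem_iUnion, mem_ofPred_eq, not_exists, not_not] at hne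
  refine hξ (tendsto_nhds_unique (((coeffCLM ξ).continuous.tendsto v).comp huv) ?_)
  exact tendsto_const_nhds.congr fun k => (hne k).symm

lemma countable_spectrum (u : Besicovitch N) : {ξ | coeffCLM ξ u ≠ 0}.Countable := by
  have hchar : Submodule.span ℂ (range char) ≤ countableSpectrum N := by
    refine Submodule.span_le.2 (range_subset_iff.2 fun η => mem_countableSpectrum.2 ?_)
    exact (countable_singleton η).mono fun ξ hξ => not_not.1 fun hne => hξ (coeffCLM_char_of_ne hne)
  have htop := Submodule.topologicalClosure_minimal _ hchar isClosed_countableSpectrum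
  rw [topologicalClosure_span_char] at htop
  exact mem_countableSpectrum.1 (htop Submodule.mem_top)

lemma exists_countable_ae_coeffCLM_eq_zero {X : Type*} [MeasurableSpace X] {μ : Measure X}
    {v : X → Besicovitch N} (hv : AEStronglyMeasurable v μ) :
    ∃ Λ : Set (Euc N), Λ.Countable ∧ ∀ᵐ x ∂μ, ∀ ξ ∉ Λ, coeffCLM ξ (v x) = 0 := by
  obtain ⟨t, ⟨c, hc, htc⟩, hvt⟩ := hv.isSeparable_ae_range
  refine ⟨⋃ u ∈ c, {ξ | coeffCLM ξ u ≠ 0}, hc.biUnion fun u _ => u.countable_spectrum,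
    hvt.mono fun x hx ξ hξ => ?_⟩
  simp only [mem_iUnion, mem_ofPred_eq, not_exists, not_not] at hξ
  exact closure_minimal (s := c) hξ (coeffCLM ξ).isClosed_ker (htc hx)

end Besicovitch

/-- Countability of the spectrum turns "for every `ξ`, almost everywhere" into "almost everywhere,
for every `ξ`". -/
lemma ae_formalDiv_eq_zero_of_forall {X : Type*} [MeasurableSpace X] {μ : Measure X}
    (σ : Fin 3 → Fin N) {v : X → Fin 3 → Besicovitch N}
    (hv : ∀ j, AEStronglyMeasurable (fun x => v x j) μ)
    (h : ∀ ξ, ∀ᵐ x ∂μ, formalDiv σ (fun j => v x j) ξ = 0) :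
    ∀ᵐ x ∂μ, formalDiv σ (fun j => v x j) = 0 := by
  choose Λ hΛ hvΛ using fun j => Besicovitch.exists_countable_ae_coeffCLM_eq_zero (hv j)
  filter_upwards [(ae_ball_iff (countable_iUnion hΛ)).2 fun ξ _ => h ξ, ae_all_iff.2 hvΛ]
    with x hin hout
  funext ξ
  by_cases hξ : ξ ∈ ⋃ j, Λ j
  · exact hin ξ hξ
  · simp only [mem_iUnion, not_exists] at hξ
    exact Finset.sum_eq_zero fun j _ => by
      rw [← Besicovitch.coeffCLM_apply, hout j ξ (hξ j), mul_zero]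

/-! ### Periodic functions are multipliers -/

/-- Periodicity with period the unit cube. -/
def UnitPeriodic {β : Type*} (f : Euc N → β) : Prop :=
  ∀ k, Function.Periodic f (EuclideanSpace.single k 1)

/-- The unit cube, half-open so that its integer translates tile `ℝ^N`. -/
def unitCube (N : ℕ) : Set (Euc N) := {y | ∀ i, y i ∈ Ioc (0 : ℝ) 1}

/-- The point of `ℝ^N` with integer coordinates `k`. -/
def intPoint (k : Fin N → ℤ) : Euc N := WithLp.toLp 2 fun i => (k i : ℝ)

lemma measurableSet_unitCube : MeasurableSet (unitCube N) := by
  have : unitCube N = ⋂ i, (fun y : Euc N => y i) ⁻¹' Ioc (0 : ℝ) 1 := by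
    ext y; simp [unitCube]
  rw [this]
  exact MeasurableSet.iInter fun i => measurableSet_Ioc.preimage (by fun_prop)

lemma UnitPeriodic.periodic_intPoint {β : Type*} {f : Euc N → β} (hf : UnitPeriodic f)
    (k : Fin N → ℤ) : Function.Periodic f (intPoint k) := by
  have hk : intPoint k = ∑ i, k i • (EuclideanSpace.single i 1 : Euc N) := by
    ext j
    simp [intPoint, Pi.single_apply]
  rw [hk]
  exact Finset.sum_induction _ (Function.Periodic f) (fun _ _ => Function.Periodic.add_period)
    (fun y => by rw [add_zero]) fun i _ => (hf i).zsmul (k i)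

lemma UnitPeriodic.setLIntegral_unitCube_translate {f : Euc N → ℝ≥0∞} (hf : UnitPeriodic f)
    (k : Fin N → ℤ) :
    ∫⁻ y in (· - intPoint k) ⁻¹' unitCube N, f y = ∫⁻ y in unitCube N, f y := by
  have h := (measurePreserving_sub_right volume (intPoint k)).setLIntegral_comp_preimage_emb
    (measurableEmbedding_subRight _) f (unitCube N)
  simpa only [(hf.periodic_intPoint k).sub_eq] using h

lemma ball_subset_iUnion_unitCube {n : ℕ} : Metric.ball (0 : Euc N) n ⊆
    ⋃ k : Fintype.piFinset fun _ : Fin N => Finset.Ico (-n : ℤ) n,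
      (· - intPoint k.1) ⁻¹' unitCube N := by
  intro y hy
  rw [mem_ball_zero_iff] at hy
  refine mem_iUnion.2 ⟨⟨fun i => ⌈y i⌉ - 1, Fintype.mem_piFinset.2 fun i => ?_⟩, fun i => ?_⟩
  · obtain ⟨hlt, hgt⟩ := abs_lt.1 ((PiLp.norm_apply_le y i).trans_lt hy)
    have hceil : (-n : ℤ) < ⌈y i⌉ := Int.lt_ceil.2 (by push_cast; exact hlt)
    have hceil' : ⌈y i⌉ ≤ (n : ℤ) := Int.ceil_le.2 (by push_cast; exact hgt.le)
    rw [Finset.mem_Ico]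
    omega
  · have hle := Int.le_ceil (y i)
    have hlt := Int.ceil_lt_add_one (y i)
    simp only [intPoint, PiLp.sub_apply, mem_Ioc]
    push_cast
    constructor <;> linarith

lemma UnitPeriodic.setLIntegral_ball_le {f : Euc N → ℝ≥0∞} (hf : UnitPeriodic f) (n : ℕ) :
    ∫⁻ y in Metric.ball 0 n, f y ≤ (2 * n) ^ N * ∫⁻ y in unitCube N, f y := by
  refine (lintegral_mono_set ball_subset_iUnion_unitCube).trans ((lintegral_iUnion_le _ _).trans ?_)
  simp only [hf.setLIntegral_unitCube_translate, tsum_fintype, Finset.sum_const, Finset.card_univ,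
    Fintype.card_coe, Fintype.card_piFinset, Int.card_Ico, nsmul_eq_mul, Finset.prod_const,
    Fintype.card_fin]
  have hcard : ((n : ℤ) - -(n : ℤ)).toNat = 2 * n := by omega
  rw [hcard]
  push_cast
  exact le_rfl

lemma UnitPeriodic.upperMeanSq_le {u : Euc N → ℂ} (hu : UnitPeriodic u) :
    upperMeanSq u ≤ 2 ^ N * (volume (Metric.ball (0 : Euc N) 1))⁻¹ *
      eLpNorm u 2 (volume.restrict (unitCube N)) ^ 2 := by
  have hsq : eLpNorm u 2 (volume.restrict (unitCube N)) ^ 2 = ∫⁻ y in unitCube N, ‖u y‖ₑ ^ 2 := by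
    simpa using eLpNorm_nnreal_pow_eq_lintegral (f := u) (μ := volume.restrict (unitCube N))
      (p := 2) two_ne_zero
  have hu' : UnitPeriodic fun y => ‖u y‖ₑ ^ 2 := fun k y => by simp only [hu k y]
  rw [hsq]
  refine limsup_le_of_le (by isBoundedDefault) ?_
  filter_upwards [eventually_ne_atTop 0] with n hn
  have hvol : volume (Metric.ball (0 : Euc N) n) = n ^ N * volume (Metric.ball (0 : Euc N) 1) := by
    rw [Measure.addHaar_ball_of_pos _ _ (Nat.cast_pos.2 (Nat.pos_of_ne_zero hn)),
      finrank_euclideanSpace_fin, ENNReal.ofReal_pow n.cast_nonneg, ENNReal.ofReal_natCast]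
  have hn0 : (n : ℝ≥0∞) ^ N ≠ 0 := pow_ne_zero _ (Nat.cast_ne_zero.2 hn)
  have hn1 : (n : ℝ≥0∞) ^ N ≠ ∞ := by finiteness
  calc (volume (Metric.ball (0 : Euc N) n))⁻¹ * ∫⁻ y in Metric.ball 0 n, ‖u y‖ₑ ^ 2
      ≤ (volume (Metric.ball (0 : Euc N) n))⁻¹ *
          ((2 * n) ^ N * ∫⁻ y in unitCube N, ‖u y‖ₑ ^ 2) := by
        gcongr
        exact hu'.setLIntegral_ball_le n
    _ = ((n : ℝ≥0∞) ^ N * ((n : ℝ≥0∞) ^ N)⁻¹) * (2 ^ N * (volume (Metric.ball (0 : Euc N) 1))⁻¹ *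
          ∫⁻ y in unitCube N, ‖u y‖ₑ ^ 2) := by
        rw [hvol, ENNReal.mul_inv (.inl hn0) (.inl hn1), mul_pow]
        ring
    _ = _ := by rw [ENNReal.mul_inv_cancel hn0 hn1, one_mul]

/-- The circle carries its Haar probability measure, as in the multivariate Fourier series of
Mathlib, where this instance is local. -/
local instance unitCircleMeasureSpace : MeasureSpace UnitAddCircle := ⟨AddCircle.haarAddCircle⟩

local instance unitCircle_isProbabilityMeasure :
    IsProbabilityMeasure (volume : Measure UnitAddCircle) :=
  inferInstanceAs (IsProbabilityMeasure AddCircle.haarAddCircle)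

/-- The projection of `ℝ^N` onto the torus. -/
def torusMk (y : Euc N) : UnitAddTorus (Fin N) := fun i => y i

/-- The section of `torusMk` with values in the unit cube. -/
def cubeSection (t : UnitAddTorus (Fin N)) : Euc N :=
  WithLp.toLp 2 (UnitAddTorus.measurableEquivPiIoc (0 : Fin N → ℝ) t).1

lemma torusMk_cubeSection (t : UnitAddTorus (Fin N)) : torusMk (cubeSection t) = t :=
  (UnitAddTorus.measurableEquivPiIoc (0 : Fin N → ℝ)).symm_apply_apply t

lemma torusMk_add_single (y : Euc N) (k : Fin N) :
    torusMk (y + EuclideanSpace.single k 1) = torusMk y := by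
  funext i
  by_cases hi : i = k
  · subst hi
    simp [torusMk]
  · simp [torusMk, hi]

lemma measurePreserving_cubeSection :
    MeasurePreserving cubeSection volume (volume.restrict (unitCube N)) := by
  have hcube : {x : Fin N → ℝ | ∀ i, x i ∈ Ioc ((0 : Fin N → ℝ) i) ((0 : Fin N → ℝ) i + 1)} =
      WithLp.toLp 2 ⁻¹' unitCube N := by
    ext x
    simp [unitCube]
  have hmeas : MeasurableSet (WithLp.toLp 2 ⁻¹' unitCube N : Set (Fin N → ℝ)) :=
    measurableSet_unitCube.preimage (by fun_prop)
  have hincl := measurePreserving_subtype_coe (μa := volume) (hcube ▸ hmeas)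
  have htoLp := (PiLp.volume_preserving_toLp (Fin N)).restrict_preimage measurableSet_unitCube
  rw [← hcube] at htoLp
  exact htoLp.comp (hincl.comp (UnitAddTorus.measurePreserving_equivPiIoc 0))

instance isFiniteMeasure_unitCube : IsFiniteMeasure (volume.restrict (unitCube N)) := by
  rw [← measurePreserving_cubeSection.map_eq]
  infer_instance

lemma mFourier_torusMk (k : Fin N → ℤ) (y : Euc N) :
    UnitAddTorus.mFourier k (torusMk y) = innerProbChar ((2 * Real.pi) • intPoint k) y := by
  rw [BoundedContinuousFunction.innerProbChar_apply]
  simp only [UnitAddTorus.mFourier, torusMk, ContinuousMap.coe_mk, fourier_coe_apply,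
    ← Complex.exp_sum]
  congr 1
  simp only [PiLp.inner_apply, RCLike.inner_apply, conj_trivial]
  push_cast
  rw [Finset.sum_mul]
  refine Finset.sum_congr rfl fun i _ => ?_
  simp [intPoint]
  ring

lemma exists_trig_eq_comp_torusMk {G : C(UnitAddTorus (Fin N), ℂ)}
    (hG : G ∈ Submodule.span ℂ (range UnitAddTorus.mFourier)) :
    ∃ g ∈ trig N, ⇑g = G ∘ torusMk := by
  induction hG using Submodule.span_induction with
  | mem _ h =>
    obtain ⟨k, rfl⟩ := h
    exact ⟨_, innerProbChar_mem_trig _, funext fun y => (mFourier_torusMk k y).symm⟩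
  | zero => exact ⟨0, zero_mem _, rfl⟩
  | add _ _ _ _ h h' =>
    obtain ⟨g, hg, hgG⟩ := h
    obtain ⟨g', hg', hgG'⟩ := h'
    exact ⟨g + g', add_mem hg hg', congrArg₂ (· + ·) hgG hgG'⟩
  | smul c _ _ h =>
    obtain ⟨g, hg, hgG⟩ := h
    exact ⟨c • g, Submodule.smul_mem _ c hg, congrArg (c • ·) hgG⟩

lemma exists_mem_span_mFourier_eLpNorm_sub_lt {ι : Type*} [Fintype ι] {F : UnitAddTorus ι → ℂ}
    (hF : MemLp F 2 volume) {δ : ℝ≥0∞} (hδ : 0 < δ) :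
    ∃ G ∈ Submodule.span ℂ (range UnitAddTorus.mFourier), eLpNorm (F - ⇑G) 2 volume < δ := by
  have hmem : hF.toLp F ∈ (Submodule.span ℂ
      (range (UnitAddTorus.mFourierLp (d := ι) 2))).topologicalClosure := by
    rw [UnitAddTorus.span_mFourierLp_closure_eq_top (p := 2) ENNReal.ofNat_ne_top]
    exact Submodule.mem_top
  obtain ⟨q, hq, hFq⟩ := EMetric.mem_closure_iff.1 hmem δ hδ
  have hrange : range (UnitAddTorus.mFourierLp (d := ι) 2) =
      (ContinuousMap.toLp 2 volume ℂ).toLinearMap '' range UnitAddTorus.mFourier :=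
    range_comp _ _
  rw [hrange, ← Submodule.map_span] at hq
  obtain ⟨G, hG, rfl⟩ := hq
  refine ⟨G, hG, ?_⟩
  rw [Lp.edist_def] at hFq
  refine (eLpNorm_congr_ae ?_).trans_lt hFq
  exact hF.coeFn_toLp.symm.sub (ContinuousMap.coeFn_toLp volume G).symm

lemma exists_trig_unitPeriodic_eLpNorm_sub_lt {u : Euc N → ℂ}
    (hu : MemLp u 2 (volume.restrict (unitCube N))) {δ : ℝ≥0∞} (hδ : 0 < δ) :
    ∃ g ∈ trig N, UnitPeriodic g ∧ eLpNorm (u - ⇑g) 2 (volume.restrict (unitCube N)) < δ := by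
  obtain ⟨G, hG, hlt⟩ := exists_mem_span_mFourier_eLpNorm_sub_lt
    (hu.comp_measurePreserving measurePreserving_cubeSection) hδ
  obtain ⟨g, hg, hgG⟩ := exists_trig_eq_comp_torusMk hG
  refine ⟨g, hg, fun k y => by simp only [hgG, Function.comp_apply, torusMk_add_single], ?_⟩
  have hcomp : u ∘ cubeSection - ⇑G = (u - ⇑g) ∘ cubeSection := by
    funext t
    simp only [hgG, Pi.sub_apply, Function.comp_apply, torusMk_cubeSection]
  rwa [hcomp, eLpNorm_comp_measurePreserving (hu.1.sub g.continuous.aestronglyMeasurable)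
    measurePreserving_cubeSection] at hlt

lemma UnitPeriodic.isMultiplier {m : Euc N → ℂ} (hper : UnitPeriodic m) (hm : MemLp m ∞ volume) :
    IsMultiplier m := by
  refine ⟨⟨fun K hK => ?_, fun δ hδ => ?_⟩, hm⟩
  · have : IsFiniteMeasure (volume.restrict K) := isFiniteMeasure_restrict.2 hK.measure_ne_top
    exact (hm.restrict K).mono_exponent le_top
  set D : ℝ≥0∞ := 2 ^ N * (volume (Metric.ball (0 : Euc N) 1))⁻¹
  have hD : D ≠ ∞ := ENNReal.mul_ne_top (by finiteness)
    (ENNReal.inv_ne_top.2 (Metric.measure_ball_pos volume _ one_pos).ne')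
  have hsmall : Tendsto (fun r : ℝ≥0∞ => D * r ^ 2) (𝓝 0) (𝓝 0) := by
    simpa using ENNReal.Tendsto.const_mul (ENNReal.continuous_pow 2 |>.tendsto 0) (.inr hD)
  obtain ⟨θ, hθ, hlt⟩ :=
    (ENNReal.nhds_zero_basis.eventually_iff).1 (hsmall.eventually_lt_const hδ)
  obtain ⟨g, hg, hgper, hmg⟩ := exists_trig_unitPeriodic_eLpNorm_sub_lt
    ((hm.restrict (unitCube N)).mono_exponent le_top) hθ
  have hsub : UnitPeriodic (m - ⇑g) := fun k y => by
    simp only [Pi.sub_apply, hper k y, hgper k y]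
  exact ⟨g, hg, hsub.upperMeanSq_le.trans_lt (hlt hmg)⟩

/-! ### Two-scale convergence tested with multipliers -/

lemma memLp_clm_comp {X 𝕜 E F : Type*} [MeasurableSpace X] {μ : Measure X}
    [NontriviallyNormedField 𝕜] [SeminormedAddCommGroup E] [NormedSpace 𝕜 E]
    [SeminormedAddCommGroup F] [NormedSpace 𝕜 F] (L : E →L[𝕜] F) {v : X → E} {p : ℝ≥0∞}
    (hv : MemLp v p μ) : MemLp (fun x => L (v x)) p μ :=
  hv.of_enorm_le_mul (c := ‖L‖₊) (L.continuous.comp_aestronglyMeasurable hv.1)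
    (.of_forall fun x => L.le_opENorm (v x))

lemma memLp_top_comp_smul {m : Euc N → ℂ} (hm : MemLp m ∞ volume) (a : ℝ) :
    MemLp (fun x => m (a • x)) ∞ volume := by
  rcases eq_or_ne a 0 with rfl | ha
  · simpa only [zero_smul] using memLp_top_const (m 0)
  · refine MemLp.comp_of_map (f := (a • ·)) ?_ (measurable_const_smul a).aemeasurable
    rw [Measure.map_addHaar_smul _ ha]
    exact hm.smul_measure ENNReal.ofReal_ne_top

lemma IsMultiplier.sub {m m' : Euc N → ℂ} (hm : IsMultiplier m) (hm' : IsMultiplier m') :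
    IsMultiplier (m - m') :=
  ⟨(besicovitchSubmodule N).sub_mem hm.besicovitch hm'.besicovitch, hm.bounded.sub hm'.bounded⟩

section MeanValue

variable {X : Type*} [MeasurableSpace X] {μ : Measure X} {m m' : Euc N → ℂ}
  {v : X → Besicovitch N}

lemma meanValue_sub_mul (hm : IsMultiplier m) (hm' : IsMultiplier m') (u : Besicovitch N) :
    meanValue ((m - m') * ⇑u) = meanValue (m * ⇑u) - meanValue (m' * ⇑u) := by
  rw [sub_mul]
  exact ((hm.mul_isBesicovitch u.isBesicovitch).hasMeanValue.sub
    (hm'.mul_isBesicovitch u.isBesicovitch).hasMeanValue).meanValue_eq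

lemma memLp_meanValue_mul (hm : IsMultiplier m) (hv : MemLp v 2 μ) :
    MemLp (fun x => meanValue (m * ⇑(v x))) 2 μ :=
  memLp_clm_comp (Besicovitch.meanCLM N ∘L Besicovitch.mulCLM hm) hv

lemma eLpNorm_meanValue_mul_le (hm : IsMultiplier m) :
    eLpNorm (fun x => meanValue (m * ⇑(v x))) 2 μ ≤ besNorm m * eLpNorm v 2 μ := by
  rw [← ENNReal.coe_toNNReal hm.besicovitch.besNorm_ne_top]
  refine eLpNorm_le_nnreal_smul_eLpNorm_of_ae_le_mul' (.of_forall fun x => ?_) 2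
  rw [ENNReal.coe_toNNReal hm.besicovitch.besNorm_ne_top, Besicovitch.enorm_eq]
  have hvx := (v x).isBesicovitch
  have hloc : LocL2 (v x) := hvx.locL2
  exact (hm.mul_isBesicovitch hvx).hasMeanValue.enorm_mul_le hm.bounded.1
    hloc.aestronglyMeasurable hm.besicovitch.besNorm_ne_top hvx.besNorm_ne_top

end MeanValue

/-- Vague convergence of `w n` to `c` in `Ω`, i.e. against continuous functions with compact support
in `Ω`; it is used for functions that are locally integrable in `Ω`. -/
def VagueTendsto (Ω : Set (Euc N)) (w : ℕ → Euc N → ℂ) (c : Euc N → ℂ) : Prop :=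
  ∀ φ : Euc N → ℂ, Continuous φ → HasCompactSupport φ → tsupport φ ⊆ Ω →
    Tendsto (fun n => ∫ x in Ω, w n x * φ x) atTop (𝓝 (∫ x in Ω, c x * φ x))

lemma integrable_mul_of_hasCompactSupport {X R : Type*} [MeasurableSpace X] [TopologicalSpace X]
    [OpensMeasurableSpace X] [T2Space X] [NormedRing R] {μ : Measure X} {w φ : X → R}
    (hw : LocallyIntegrable w μ) (hφ : Continuous φ) (hφc : HasCompactSupport φ) :
    Integrable (fun x => w x * φ x) μ :=
  hw.integrable_smul_right_of_hasCompactSupport hφ hφc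

lemma VagueTendsto.sum {ι : Type*} {s : Finset ι} {Ω : Set (Euc N)} {w : ι → ℕ → Euc N → ℂ}
    {c : ι → Euc N → ℂ} (hw : ∀ j ∈ s, ∀ n, LocallyIntegrable (w j n) (volume.restrict Ω))
    (hc : ∀ j ∈ s, LocallyIntegrable (c j) (volume.restrict Ω))
    (h : ∀ j ∈ s, VagueTendsto Ω (w j) (c j)) :
    VagueTendsto Ω (fun n x => ∑ j ∈ s, w j n x) fun x => ∑ j ∈ s, c j x := by
  intro φ hφ hφc hφΩ
  simp only [Finset.sum_mul]
  rw [integral_finsetSum s fun j hj => integrable_mul_of_hasCompactSupport (hc j hj) hφ hφc]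
  refine (tendsto_finsetSum s fun j hj => h j hj φ hφ hφc hφΩ).congr fun n => ?_
  exact (integral_finsetSum s fun j hj =>
    integrable_mul_of_hasCompactSupport (hw j hj n) hφ hφc).symm

lemma TwoScaleTendsto.vagueTendsto_trig {Ω : Set (Euc N)} {ε : ℕ → ℝ} {u : ℕ → Euc N → ℂ}
    {v : Euc N → Besicovitch N} (h : TwoScaleTendsto Ω ε u v) {p : Euc N →ᵇ ℂ} (hp : p ∈ trig N) :
    VagueTendsto Ω (fun n x => p ((ε n)⁻¹ • x) * u n x) fun x => meanValue (⇑p * ⇑(v x)) := by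
  intro φ hφ hφc hφΩ
  have hlim := h.tendsto (fun x => φ x • p) (hφ.smul continuous_const) hφc.smul_right
    ((tsupport_smul_subset_left φ _).trans hφΩ)
    fun x => Submodule.le_topologicalClosure _ (Submodule.smul_mem _ (φ x) hp)
  have hmean (x : Euc N) :
      meanValue (fun y => v x y * (φ x • p) y) = meanValue (⇑p * ⇑(v x)) * φ x := by
    have hpv := (isMultiplier_of_mem_trig hp).mul_isBesicovitch (v x).isBesicovitch
    rw [mul_comm, ← (hpv.hasMeanValue.smul (φ x)).meanValue_eq]
    congr 1
    funext y
    simp only [BoundedContinuousFunction.coe_smul, Pi.smul_apply, Pi.mul_apply, smul_eq_mul]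
    ring
  simp only [hmean] at hlim
  refine hlim.congr fun n => integral_congr_ae (.of_forall fun x => ?_)
  simp only [BoundedContinuousFunction.coe_smul, smul_eq_mul]
  ring

lemma locallyIntegrable_multiplier_mul {Ω : Set (Euc N)} {m u : Euc N → ℂ} (hm : IsMultiplier m)
    (hu : MemLp u 2 (volume.restrict Ω)) (a : ℝ) :
    LocallyIntegrable (fun x => m (a • x) * u x) (volume.restrict Ω) :=
  (hu.mul (r := 2) ((memLp_top_comp_smul hm.bounded a).restrict Ω)).locallyIntegrable one_le_two

lemma BoundedL2.exists_limsup_enorm_integral_le {Ω : Set (Euc N)} {ε : ℕ → ℝ}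
    {u : ℕ → Euc N → ℂ} (hu : BoundedL2 Ω u) (hε : Tendsto ε atTop (𝓝[>] 0)) {φ : Euc N → ℂ}
    (hφ : Continuous φ) (hφc : HasCompactSupport φ) :
    ∃ C : ℝ≥0∞, C ≠ ∞ ∧ ∀ w : Euc N → ℂ, MemLp w ∞ volume →
      limsup (fun n => ‖∫ x in Ω, w ((ε n)⁻¹ • x) * u n x * φ x‖ₑ) atTop ≤ C * besNorm w := by
  obtain ⟨hu2, C, hC⟩ := hu
  obtain ⟨R, hR, hφR⟩ := hφc.isCompact.isBounded.subset_ball_lt 0 0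
  set D : ℝ≥0∞ := eLpNorm φ ∞ volume * C
  have hD : D ≠ ∞ :=
    ENNReal.mul_ne_top (hφ.memLp_of_hasCompactSupport hφc).2.ne ENNReal.coe_ne_top
  refine ⟨D * volume (Metric.ball (0 : Euc N) (R + 1)) ^ (1 / 2 : ℝ), ENNReal.mul_ne_top hD
    (ENNReal.rpow_ne_top_of_nonneg (by norm_num) measure_ball_lt_top.ne), fun w hw => ?_⟩
  have hle (n : ℕ) : ‖∫ x in Ω, w ((ε n)⁻¹ • x) * u n x * φ x‖ₑ ≤
      D * eLpNorm (fun x => w ((ε n)⁻¹ • x)) 2 (volume.restrict (tsupport φ)) := by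
    refine (enorm_integral_mul_mul_le (memLp_top_comp_smul hw _).1.restrict (hu2 n).1
      hφ.aestronglyMeasurable (subset_tsupport φ)).trans ?_
    refine mul_le_mul' (mul_le_mul' ?_ (hC n)) ?_
    · exact eLpNorm_mono_measure φ Measure.restrict_le_self
    · exact eLpNorm_mono_measure _ (Measure.restrict_mono_measure Measure.restrict_le_self _)
  calc limsup (fun n => ‖∫ x in Ω, w ((ε n)⁻¹ • x) * u n x * φ x‖ₑ) atTop
      ≤ limsup (fun n => D * eLpNorm (fun x => w ((ε n)⁻¹ • x)) 2
          (volume.restrict (tsupport φ))) atTop := limsup_le_limsup (.of_forall hle)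
    _ = D * limsup (fun n => eLpNorm (fun x => w ((ε n)⁻¹ • x)) 2
          (volume.restrict (tsupport φ))) atTop := ENNReal.limsup_const_mul_of_ne_top hD
    _ ≤ D * volume (Metric.ball (0 : Euc N) (R + 1)) ^ (1 / 2 : ℝ) * besNorm w :=
        (mul_le_mul_right (limsup_eLpNorm_comp_inv_smul_le hε hR hφR w) D).trans_eq
          (mul_assoc D _ _).symm

lemma edist_integral_meanValue_mul_le {Ω : Set (Euc N)} {v : Euc N → Besicovitch N}
    {m m' : Euc N → ℂ} (hm : IsMultiplier m) (hm' : IsMultiplier m')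
    (hv : MemLp v 2 (volume.restrict Ω)) {φ : Euc N → ℂ} (hφ : Continuous φ)
    (hφc : HasCompactSupport φ) :
    edist (∫ x in Ω, meanValue (m * ⇑(v x)) * φ x) (∫ x in Ω, meanValue (m' * ⇑(v x)) * φ x) ≤
      eLpNorm v 2 (volume.restrict Ω) * eLpNorm φ 2 (volume.restrict Ω) * besNorm (m - m') := by
  have hint {m : Euc N → ℂ} (hm : IsMultiplier m) :
      Integrable (fun x => meanValue (m * ⇑(v x)) * φ x) (volume.restrict Ω) :=
    integrable_mul_of_hasCompactSupport
      ((memLp_meanValue_mul hm hv).locallyIntegrable one_le_two) hφ hφc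
  rw [edist_eq_enorm_sub, ← integral_sub (hint hm) (hint hm')]
  simp only [← sub_mul, ← meanValue_sub_mul hm hm']
  calc ‖∫ x in Ω, meanValue ((m - m') * ⇑(v x)) * φ x‖ₑ
      ≤ eLpNorm (fun x => meanValue ((m - m') * ⇑(v x))) 2 (volume.restrict Ω) *
          eLpNorm φ 2 (volume.restrict Ω) :=
        enorm_integral_mul_le (memLp_meanValue_mul (hm.sub hm') hv).1 hφ.aestronglyMeasurable
    _ ≤ besNorm (m - m') * eLpNorm v 2 (volume.restrict Ω) * eLpNorm φ 2 (volume.restrict Ω) := by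
        gcongr
        exact eLpNorm_meanValue_mul_le (hm.sub hm')
    _ = _ := by ring

-- Both sides are continuous in `m` for the Besicovitch seminorm, the left one uniformly as
-- `n → ∞`: at scale `ε n` a ball of fixed radius sees the mean of `|m|²` over a large ball.
lemma TwoScaleTendsto.vagueTendsto_multiplier {Ω : Set (Euc N)} {ε : ℕ → ℝ} {u : ℕ → Euc N → ℂ}
    {v : Euc N → Besicovitch N} (h : TwoScaleTendsto Ω ε u v) (hε : Tendsto ε atTop (𝓝[>] 0))
    (hu : BoundedL2 Ω u) {m : Euc N → ℂ} (hm : IsMultiplier m) :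
    VagueTendsto Ω (fun n x => m ((ε n)⁻¹ • x) * u n x) fun x => meanValue (m * ⇑(v x)) := by
  intro φ hφ hφc hφΩ
  obtain ⟨p, hp, hmp⟩ := hm.besicovitch.exists_seq_trig
  have hsub (k : ℕ) : IsMultiplier (m - ⇑(p k)) := hm.sub (isMultiplier_of_mem_trig (hp k))
  obtain ⟨C, hC, hle⟩ := hu.exists_limsup_enorm_integral_le hε hφ hφc
  have hzero {D : ℝ≥0∞} (hD : D ≠ ∞) :
      Tendsto (fun k => D * besNorm (m - ⇑(p k))) atTop (𝓝 0) := by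
    simpa using ENNReal.Tendsto.const_mul hmp (.inr hD)
  refine tendsto_of_tendsto_limsup_edist
    (b := fun k => ∫ x in Ω, meanValue (⇑(p k) * ⇑(v x)) * φ x) (l' := atTop)
    (fun k => h.vagueTendsto_trig (hp k) φ hφ hφc hφΩ) ?_ ?_
  · have hφ2 := hφ.memLp_of_hasCompactSupport (p := 2) (μ := volume.restrict Ω) hφc
    have hD := ENNReal.mul_ne_top h.memLp_limit.2.ne hφ2.2.ne
    refine tendsto_iff_edist_tendsto_0.2 (tendsto_of_tendsto_of_tendsto_of_le_of_le
      tendsto_const_nhds (hzero hD) (fun _ => zero_le) fun k => ?_)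
    rw [edist_comm]
    exact edist_integral_meanValue_mul_le hm (isMultiplier_of_mem_trig (hp k)) h.memLp_limit hφ hφc
  · refine tendsto_of_tendsto_of_tendsto_of_le_of_le tendsto_const_nhds (hzero hC)
      (fun _ => zero_le) fun k => ?_
    refine le_trans (le_of_eq ?_) (hle _ (hsub k).bounded)
    congr 1
    funext n
    rw [edist_eq_enorm_sub, ← integral_sub
      (integrable_mul_of_hasCompactSupport (locallyIntegrable_multiplier_mul hm (hu.1 n) _) hφ hφc)
      (integrable_mul_of_hasCompactSupport (locallyIntegrable_multiplier_mul
        (isMultiplier_of_mem_trig (hp k)) (hu.1 n) _) hφ hφc)]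
    simp only [Pi.sub_apply, sub_mul]

/-! ### Divergence against oscillating test functions -/

lemma contDiff_innerProbChar (ξ : Euc N) : ContDiff ℝ (⊤ : ℕ∞) (innerProbChar ξ) := by
  have h : ContDiff ℝ (⊤ : ℕ∞) fun x => inner ℝ x ξ := contDiff_id.inner ℝ contDiff_const
  exact ((Complex.ofRealCLM.contDiff.comp h).mul contDiff_const).cexp

lemma fderiv_innerProbChar_apply (ξ x v : Euc N) :
    fderiv ℝ (innerProbChar ξ) x v = Complex.I * (inner ℝ ξ v : ℝ) * innerProbChar ξ x := by
  set L : Euc N →L[ℝ] ℂ := Complex.I • Complex.ofRealCLM.comp (innerSL ℝ ξ)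
  have hL : ⇑(innerProbChar ξ) = fun x => Complex.exp (L x) := by
    funext x
    rw [BoundedContinuousFunction.innerProbChar_apply, real_inner_comm, mul_comm]
    rfl
  rw [hL, (L.hasFDerivAt (x := x)).cexp.fderiv]
  exact mul_comm _ _

lemma fderiv_innerProbChar_mul_apply {φ : Euc N → ℂ} {x : Euc N} (hφ : DifferentiableAt ℝ φ x)
    (ξ v : Euc N) :
    fderiv ℝ (⇑(innerProbChar ξ) * φ) x v = innerProbChar ξ x * fderiv ℝ φ x v +
      Complex.I * (inner ℝ ξ v : ℝ) * (innerProbChar ξ x * φ x) := by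
  rw [fderiv_mul ((contDiff_innerProbChar ξ).differentiable (by simp) x) hφ]
  simp only [add_apply, smul_apply, smul_eq_mul, fderiv_innerProbChar_apply]
  ring

lemma IsWeakDiv.sum_mul_integral_eq {Ω : Set (Euc N)} {σ : Fin 3 → Fin N} {u : Euc N → Fin 3 → ℂ}
    {d : Euc N → ℂ} (h : IsWeakDiv σ Ω u d)
    (hu : ∀ j, LocallyIntegrable (fun x => u x j) (volume.restrict Ω)) {φ : Euc N → ℂ}
    (hφ : ContDiff ℝ (⊤ : ℕ∞) φ) (hφc : HasCompactSupport φ) (hφΩ : tsupport φ ⊆ Ω) (ξ : Euc N) :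
    ∑ j, Complex.I * ξ (σ j) * ∫ x in Ω, innerProbChar ξ x * u x j * φ x =
      -((∫ x in Ω, innerProbChar ξ x * d x * φ x) + ∑ j, ∫ x in Ω,
        innerProbChar ξ x * u x j * fderiv ℝ φ x (EuclideanSpace.single (σ j) 1)) := by
  set E := innerProbChar ξ
  have hint (j : Fin 3) {χ : Euc N → ℂ} (hχ : Continuous χ) (hχc : HasCompactSupport χ) :
      Integrable (fun x => E x * u x j * χ x) (volume.restrict Ω) := by
    simpa only [Pi.mul_apply, mul_left_comm (u _ _), ← mul_assoc] using
      integrable_mul_of_hasCompactSupport (hu j) (E.continuous.mul hχ) hχc.mul_left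
  have hD (j : Fin 3) : Integrable
      (fun x => E x * u x j * fderiv ℝ φ x (EuclideanSpace.single (σ j) 1)) (volume.restrict Ω) :=
    hint j ((hφ.continuous_fderiv (by simp)).clm_apply continuous_const) (hφc.fderiv_apply ℝ _)
  have hφE (j : Fin 3) :
      Integrable (fun x => Complex.I * ξ (σ j) * (E x * u x j * φ x)) (volume.restrict Ω) :=
    (hint j hφ.continuous hφc).const_mul _
  have hderiv (x : Euc N) (j : Fin 3) :
      u x j * fderiv ℝ (⇑E * φ) x (EuclideanSpace.single (σ j) 1) =
        E x * u x j * fderiv ℝ φ x (EuclideanSpace.single (σ j) 1) +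
          Complex.I * ξ (σ j) * (E x * u x j * φ x) := by
    rw [fderiv_innerProbChar_mul_apply (hφ.differentiable (by simp) x),
      EuclideanSpace.inner_single_right, conj_trivial, one_mul]
    ring
  have hweak := h (⇑E * φ) ((contDiff_innerProbChar ξ).mul hφ) hφc.mul_left
    (tsupport_mul_subset_right.trans hφΩ)
  simp only [hderiv, Finset.sum_add_distrib] at hweak
  rw [integral_add (integrable_finsetSum _ fun j _ => hD j)
    (integrable_finsetSum _ fun j _ => hφE j), integral_finsetSum _ fun j _ => hD j,
    integral_finsetSum _ fun j _ => hφE j] at hweak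
  simp only [integral_const_mul, Pi.mul_apply, mul_left_comm (d _)] at hweak
  simp only [mul_assoc (E _) (d _)]
  linear_combination hweak

lemma BoundedL2.isBoundedUnder_norm_integral {Ω : Set (Euc N)} {u : ℕ → Euc N → ℂ}
    (hu : BoundedL2 Ω u) {w : ℕ → Euc N → ℂ} {φ : Euc N → ℂ}
    (hw : ∀ n, AEStronglyMeasurable (w n) (volume.restrict Ω))
    (hφ : MemLp φ 2 (volume.restrict Ω)) (hwφ : ∀ n x, ‖w n x‖ ≤ ‖φ x‖) :
    IsBoundedUnder (· ≤ ·) atTop fun n => ‖∫ x in Ω, w n x * u n x‖ := by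
  obtain ⟨hu2, C, hC⟩ := hu
  refine isBoundedUnder_of ⟨(eLpNorm φ 2 (volume.restrict Ω) * C).toReal, fun n => ?_⟩
  rw [← toReal_enorm]
  refine ENNReal.toReal_mono (ENNReal.mul_ne_top hφ.2.ne ENNReal.coe_ne_top) ?_
  refine (enorm_integral_mul_le (hw n) (hu2 n).1).trans ?_
  gcongr
  exacts [eLpNorm_mono (hwφ n), hC n]

-- Only the derivative of the oscillating factor of `ε φ e^{i ζ·x/ε}` is not `O(ε)`.
lemma BoundedDiv.sum_mul_integral_eq_zero {Ω : Set (Euc N)} {σ : Fin 3 → Fin N} {ε : ℕ → ℝ}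
    {u : ℕ → Euc N → Fin 3 → ℂ} {c : Fin 3 → Euc N → ℂ} {ζ : Euc N} (hdiv : BoundedDiv σ Ω u)
    (hε : Tendsto ε atTop (𝓝[>] 0))
    (hu : ∀ n j, LocallyIntegrable (fun x => u n x j) (volume.restrict Ω))
    (h : ∀ j, VagueTendsto Ω (fun n x => innerProbChar ζ ((ε n)⁻¹ • x) * u n x j) (c j))
    {φ : Euc N → ℂ} (hφ : ContDiff ℝ (⊤ : ℕ∞) φ) (hφc : HasCompactSupport φ)
    (hφΩ : tsupport φ ⊆ Ω) :
    ∑ j, Complex.I * ζ (σ j) * ∫ x in Ω, c j x * φ x = 0 := by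
  obtain ⟨d, hd, hdiv⟩ := hdiv
  have hε0 : Tendsto (fun n => (ε n : ℂ)) atTop (𝓝 0) :=
    (Complex.continuous_ofReal.tendsto' 0 0 rfl).comp (tendsto_nhds_of_tendsto_nhdsWithin hε)
  have hbdd : IsBoundedUnder (· ≤ ·) atTop fun n =>
      ‖∫ x in Ω, innerProbChar ζ ((ε n)⁻¹ • x) * d n x * φ x‖ := by
    have hφcont := hφ.continuous
    simp only [mul_right_comm _ (d _ _)]
    refine hd.isBoundedUnder_norm_integral (φ := φ) (fun n => by fun_prop)
      (hφcont.memLp_of_hasCompactSupport hφc) fun n x => ?_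
    rw [norm_mul, BoundedContinuousFunction.innerProbChar_apply, Complex.norm_exp_ofReal_mul_I,
      one_mul]
  have hderiv := tendsto_finsetSum Finset.univ fun j _ =>
    h j _ ((hφ.continuous_fderiv (by simp)).clm_apply continuous_const)
      (hφc.fderiv_apply ℝ (EuclideanSpace.single (σ j) 1))
      ((tsupport_fderiv_apply_subset ℝ _).trans hφΩ)
  have hright := ((hε0.zero_mul_isBoundedUnder_le hbdd).add (hε0.mul hderiv)).neg
  rw [zero_mul, add_zero, neg_zero] at hright
  refine tendsto_nhds_unique (tendsto_finsetSum Finset.univ fun j _ =>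
    (h j φ hφ.continuous hφc hφΩ).const_mul (Complex.I * ζ (σ j))) (hright.congr' ?_)
  filter_upwards [hε.eventually_mem self_mem_nhdsWithin] with n hn
  have hεn : (ε n : ℂ) ≠ 0 := Complex.ofReal_ne_zero.2 (ne_of_gt hn)
  have hparts := (hdiv n).sum_mul_integral_eq (hu n) hφ hφc hφΩ ((ε n)⁻¹ • ζ)
  simp only [← innerProbChar_smul_right, PiLp.smul_apply, smul_eq_mul, Complex.ofReal_mul,
    Complex.ofReal_inv, mul_left_comm Complex.I, mul_assoc (ε n : ℂ)⁻¹, ← Finset.mul_sum] at hparts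
  rw [← mul_add, ← mul_neg, ← hparts, mul_inv_cancel_left₀ hεn]

lemma BoundedDiv.ae_sum_mul_eq_zero {Ω : Set (Euc N)} {σ : Fin 3 → Fin N} {ε : ℕ → ℝ}
    {u : ℕ → Euc N → Fin 3 → ℂ} {c : Fin 3 → Euc N → ℂ} {ζ : Euc N} (hdiv : BoundedDiv σ Ω u)
    (hΩ : IsOpen Ω) (hε : Tendsto ε atTop (𝓝[>] 0))
    (hu : ∀ n j, LocallyIntegrable (fun x => u n x j) (volume.restrict Ω))
    (hc : ∀ j, LocallyIntegrable (c j) (volume.restrict Ω))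
    (h : ∀ j, VagueTendsto Ω (fun n x => innerProbChar ζ ((ε n)⁻¹ • x) * u n x j) (c j)) :
    ∀ᵐ x ∂(volume.restrict Ω), ∑ j, Complex.I * ζ (σ j) * c j x = 0 := by
  have hloc : LocallyIntegrable (fun x => ∑ j, Complex.I * ζ (σ j) * c j x) (volume.restrict Ω) :=
    locallyIntegrable_finsetSum _ fun j _ => (hc j).smul (Complex.I * ζ (σ j))
  have hae := hΩ.ae_eq_zero_of_integral_contDiff_smul_eq_zero
    (hloc.locallyIntegrableOn Ω) fun g hg hgc hgΩ => ?_
  · filter_upwards [hae, ae_restrict_mem hΩ.measurableSet] with x hx hxΩ using hx hxΩ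
  have hφ : ContDiff ℝ (⊤ : ℕ∞) fun x => (g x : ℂ) := Complex.ofRealCLM.contDiff.comp hg
  have hφc : HasCompactSupport fun x => (g x : ℂ) := hgc.comp_left Complex.ofReal_zero
  have hφΩ : tsupport (fun x => (g x : ℂ)) ⊆ Ω :=
    (closure_mono (Function.support_comp_subset Complex.ofReal_zero g)).trans hgΩ
  have hint (j : Fin 3) : Integrable (fun x => Complex.I * ζ (σ j) * (c j x * g x))
      (volume.restrict Ω) :=
    (integrable_mul_of_hasCompactSupport (hc j) hφ.continuous hφc).const_mul _
  calc ∫ x in Ω, g x • ∑ j, Complex.I * ζ (σ j) * c j x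
      = ∫ x in Ω, ∑ j, Complex.I * ζ (σ j) * (c j x * g x) := by
        simp only [Complex.real_smul, mul_comm (Complex.ofReal (g _)), Finset.sum_mul, mul_assoc]
    _ = ∑ j, Complex.I * ζ (σ j) * ∫ x in Ω, c j x * g x := by
        rw [integral_finsetSum _ fun j _ => hint j]
        simp only [integral_const_mul]
    _ = 0 := hdiv.sum_mul_integral_eq_zero hε hu h hφ hφc hφΩ

lemma BoundedDiv.ae_formalDiv_eq_zero {Ω : Set (Euc N)} {σ : Fin 3 → Fin N} {ε : ℕ → ℝ}
    {u : ℕ → Euc N → Fin 3 → ℂ} {v : Euc N → Fin 3 → Besicovitch N} (hdiv : BoundedDiv σ Ω u)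
    (hΩ : IsOpen Ω) (hε : Tendsto ε atTop (𝓝[>] 0))
    (hu : ∀ n j, LocallyIntegrable (fun x => u n x j) (volume.restrict Ω))
    (hv : ∀ j, AEStronglyMeasurable (fun x => v x j) (volume.restrict Ω))
    (hc : ∀ ζ j, LocallyIntegrable (fun x => meanValue (⇑(innerProbChar ζ) * ⇑(v x j)))
      (volume.restrict Ω))
    (h : ∀ ζ j, VagueTendsto Ω (fun n x => innerProbChar ζ ((ε n)⁻¹ • x) * u n x j)
      fun x => meanValue (⇑(innerProbChar ζ) * ⇑(v x j))) :
    ∀ᵐ x ∂(volume.restrict Ω), formalDiv σ (fun j => v x j) = 0 := by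
  refine ae_formalDiv_eq_zero_of_forall σ hv fun ξ => ?_
  filter_upwards [hdiv.ae_sum_mul_eq_zero hΩ hε hu (hc (-ξ)) (h (-ξ))] with x hx
  simpa only [formalDiv, fourierCoeff_eq_meanValue_mul, PiLp.neg_apply, Complex.ofReal_neg,
    mul_neg, neg_mul, Finset.sum_neg_distrib, neg_eq_zero] using hx

section MulVec

variable {ι κ : Type*} [Fintype κ] {P : Euc N → Matrix ι κ ℂ}

/-- The action of a matrix of multipliers on vectors with components in `𝓑²(ℝ^N)`. -/
def Besicovitch.mulVec (hP : ∀ i j, IsMultiplier fun y => P y i j) (w : κ → Besicovitch N) (i : ι) :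
    Besicovitch N :=
  ∑ j, mulCLM (hP i j) (w j)

lemma Besicovitch.coe_mulVec (hP : ∀ i j, IsMultiplier fun y => P y i j) (w : κ → Besicovitch N)
    (i : ι) : ⇑(mulVec hP w i) = fun y => (P y).mulVec (fun j => w j y) i := by
  funext y
  simp only [mulVec, coe_sum, Finset.sum_apply, coe_mulCLM, Pi.mul_apply, Matrix.mulVec, dotProduct]

lemma aestronglyMeasurable_mulVec (hP : ∀ i j, IsMultiplier fun y => P y i j) {X : Type*}
    [MeasurableSpace X] {μ : Measure X} {v : X → κ → Besicovitch N}
    (hv : ∀ j, AEStronglyMeasurable (fun x => v x j) μ) (i : ι) :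
    AEStronglyMeasurable (fun x => Besicovitch.mulVec hP (v x) i) μ :=
  Finset.univ.aestronglyMeasurable_fun_sum fun j _ =>
    (Besicovitch.mulCLM (hP i j)).continuous.comp_aestronglyMeasurable (hv j)

lemma meanValue_mul_mulVec (hP : ∀ i j, IsMultiplier fun y => P y i j) {m : Euc N → ℂ}
    (hm : IsMultiplier m) (w : κ → Besicovitch N) (i : ι) :
    meanValue (m * ⇑(Besicovitch.mulVec hP w i)) =
      ∑ j, meanValue ((m * fun y => P y i j) * ⇑(w j)) := by
  calc meanValue (m * ⇑(Besicovitch.mulVec hP w i))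
      = Besicovitch.meanCLM N (Besicovitch.mulCLM hm (Besicovitch.mulVec hP w i)) := by
        rw [Besicovitch.meanCLM_apply, Besicovitch.coe_mulCLM]
    _ = ∑ j, Besicovitch.meanCLM N (Besicovitch.mulCLM hm (Besicovitch.mulCLM (hP i j) (w j))) := by
        simp only [Besicovitch.mulVec, map_sum]
    _ = ∑ j, meanValue ((m * fun y => P y i j) * ⇑(w j)) := by
        simp only [Besicovitch.meanCLM_apply, Besicovitch.coe_mulCLM, mul_assoc]

lemma memLp_meanValue_mul_mulVec (hP : ∀ i j, IsMultiplier fun y => P y i j) {X : Type*}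
    [MeasurableSpace X] {μ : Measure X} {v : X → κ → Besicovitch N}
    (hv : ∀ j, MemLp (fun x => v x j) 2 μ) {m : Euc N → ℂ} (hm : IsMultiplier m) (i : ι) :
    MemLp (fun x => meanValue (m * ⇑(Besicovitch.mulVec hP (v x) i))) 2 μ := by
  simp only [meanValue_mul_mulVec hP hm]
  exact memLp_finsetSum _ fun j _ => memLp_meanValue_mul (hm.mul (hP i j)) (hv j)

lemma vagueTendsto_multiplier_mul_mulVec (hP : ∀ i j, IsMultiplier fun y => P y i j)
    {Ω : Set (Euc N)} {ε : ℕ → ℝ} (hε : Tendsto ε atTop (𝓝[>] 0)) {u : ℕ → Euc N → κ → ℂ}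
    {v : Euc N → κ → Besicovitch N} (hu : ∀ j, BoundedL2 Ω fun n x => u n x j)
    (h : ∀ j, TwoScaleTendsto Ω ε (fun n x => u n x j) fun x => v x j) {m : Euc N → ℂ}
    (hm : IsMultiplier m) (i : ι) :
    VagueTendsto Ω (fun n x => m ((ε n)⁻¹ • x) * (P ((ε n)⁻¹ • x)).mulVec (u n x) i)
      fun x => meanValue (m * ⇑(Besicovitch.mulVec hP (v x) i)) := by
  have hmP (j : κ) : IsMultiplier (m * fun y => P y i j) := hm.mul (hP i j)
  simpa only [Matrix.mulVec, dotProduct, Finset.mul_sum, ← mul_assoc, Pi.mul_apply,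
    meanValue_mul_mulVec hP hm] using VagueTendsto.sum (s := Finset.univ)
      (fun j _ n => locallyIntegrable_multiplier_mul (hmP j) ((h j).memLp n) (ε n)⁻¹)
      (fun j _ => (memLp_meanValue_mul (hmP j) (h j).memLp_limit).locallyIntegrable one_le_two)
      fun j _ => (h j).vagueTendsto_multiplier hε (hu j) (hmP j)

lemma locallyIntegrable_mulVec (hP : ∀ i j, IsMultiplier fun y => P y i j) {Ω : Set (Euc N)}
    {u : Euc N → κ → ℂ} (hu : ∀ j, MemLp (fun x => u x j) 2 (volume.restrict Ω)) (a : ℝ) (i : ι) :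
    LocallyIntegrable (fun x => (P (a • x)).mulVec (u x) i) (volume.restrict Ω) :=
  locallyIntegrable_finsetSum _ fun j _ => locallyIntegrable_multiplier_mul (hP i j) (hu j) a

end MulVec

lemma BoundedL2.component {ι : Type*} [Fintype ι] {Ω : Set (Euc N)} {u : ℕ → Euc N → ι → ℂ}
    (hu : BoundedL2 Ω u) (j : ι) : BoundedL2 Ω fun n x => u n x j := by
  obtain ⟨hu2, C, hC⟩ := hu
  exact ⟨fun n => memLp_pi_iff.1 (hu2 n) j, C,
    fun n => (eLpNorm_mono fun x => norm_le_pi_norm (u n x) j).trans (hC n)⟩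

section Divergence

variable {Ω : Set (Euc N)} {σ : Fin 3 → Fin N} {ε : ℕ → ℝ} {u : ℕ → Euc N → Fin 3 → ℂ}
  {v : Euc N → Fin 3 → Besicovitch N}

lemma ae_formalDiv_eq_zero_of_twoScaleTendsto (hΩ : IsOpen Ω) (hε : Tendsto ε atTop (𝓝[>] 0))
    (hdiv : BoundedDiv σ Ω u) (h : ∀ j, TwoScaleTendsto Ω ε (fun n x => u n x j) fun x => v x j) :
    ∀ᵐ x ∂(volume.restrict Ω), formalDiv σ (fun j => v x j) = 0 :=
  hdiv.ae_formalDiv_eq_zero hΩ hε (fun n j => ((h j).memLp n).locallyIntegrable one_le_two)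
    (fun j => (h j).memLp_limit.1) (fun ζ j => (memLp_meanValue_mul (isMultiplier_innerProbChar ζ)
      (h j).memLp_limit).locallyIntegrable one_le_two)
    fun ζ j => (h j).vagueTendsto_trig (innerProbChar_mem_trig ζ)

lemma ae_formalDiv_mulVec_eq_zero {P : Euc N → Matrix (Fin 3) (Fin 3) ℂ}
    (hP : ∀ i j, IsMultiplier fun y => P y i j) (hΩ : IsOpen Ω) (hε : Tendsto ε atTop (𝓝[>] 0))
    (hu : BoundedL2 Ω u)
    (hdiv : BoundedDiv σ Ω fun n x => (P ((ε n)⁻¹ • x)).mulVec (u n x))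
    (h : ∀ j, TwoScaleTendsto Ω ε (fun n x => u n x j) fun x => v x j) :
    ∀ᵐ x ∂(volume.restrict Ω),
      formalDiv σ (fun i y => (P y).mulVec (fun j => v x j y) i) = 0 := by
  refine Eventually.mono ?_ fun x hx => (congrArg (formalDiv σ)
    (funext fun i => Besicovitch.coe_mulVec hP (v x) i)).symm.trans hx
  exact hdiv.ae_formalDiv_eq_zero hΩ hε
    (fun n => locallyIntegrable_mulVec hP (fun j => (h j).memLp n) (ε n)⁻¹)
    (aestronglyMeasurable_mulVec hP fun j => (h j).memLp_limit.1)
    (fun ζ i => (memLp_meanValue_mul_mulVec hP (fun j => (h j).memLp_limit)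
      (isMultiplier_innerProbChar ζ) i).locallyIntegrable one_le_two)
    fun ζ => vagueTendsto_multiplier_mul_mulVec hP hε hu.component h (isMultiplier_innerProbChar ζ)

end Divergence

lemma isOpen_timeSpace (T : ℝ) : IsOpen (timeSpace T) :=
  isOpen_Ioo.preimage (by fun_prop : Continuous fun z : Euc 4 => z 0)

lemma IsCoefficient.isMultiplier {P : Euc 3 → Matrix (Fin 3) (Fin 3) ℂ} (hP : IsCoefficient P)
    (i j : Fin 3) : IsMultiplier fun y => P y i j :=
  UnitPeriodic.isMultiplier (fun k y => by rw [hP.periodic k y]) (hP.bounded i j)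

end TwoScaleMaxwell

end

theorem proposition3p1_general {M N : ℕ} {Ω : Set (Euc M)} {Ω' : Set (Euc N)} (hΩ : IsOpen Ω)
    (hΩ' : IsOpen Ω') {σ : Fin 3 → Fin M} {τ : Fin 3 → Fin N} {ε : ℕ → ℝ}
    (hε : Tendsto ε atTop (𝓝[>] 0)) {P : Euc N → Matrix (Fin 3) (Fin 3) ℂ}
    (hP : ∀ i j, IsMultiplier fun y => P y i j)
    {f g : ℕ → Euc M → Fin 3 → ℂ} {B0 E0 : ℕ → Euc N → Fin 3 → ℂ} (hE0 : BoundedL2 Ω' E0)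
    (hdivf : BoundedDiv σ Ω f) (hdivg : BoundedDiv σ Ω g)
    (hdivE0 : BoundedDiv τ Ω' fun n x => (P ((ε n)⁻¹ • x)).mulVec (E0 n x))
    (hdivB0 : BoundedDiv τ Ω' B0)
    {fhat ghat : Euc M → Fin 3 → Besicovitch M} {B0hat E0hat : Euc N → Fin 3 → Besicovitch N}
    (hfhat : ∀ j, TwoScaleTendsto Ω ε (fun n z => f n z j) fun z => fhat z j)
    (hghat : ∀ j, TwoScaleTendsto Ω ε (fun n z => g n z j) fun z => ghat z j)
    (hB0hat : ∀ j, TwoScaleTendsto Ω' ε (fun n x => B0 n x j) fun x => B0hat x j)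
    (hE0hat : ∀ j, TwoScaleTendsto Ω' ε (fun n x => E0 n x j) fun x => E0hat x j) :
    (∀ᵐ z ∂(volume.restrict Ω), formalDiv σ (fun j => fhat z j) = 0) ∧
    (∀ᵐ z ∂(volume.restrict Ω), formalDiv σ (fun j => ghat z j) = 0) ∧
    (∀ᵐ x ∂(volume.restrict Ω'), formalDiv τ (fun j => B0hat x j) = 0) ∧
    (∀ᵐ x ∂(volume.restrict Ω'),
      (∀ i, IsBesicovitch fun y => (P y).mulVec (fun j => E0hat x j y) i) ∧
      formalDiv τ (fun i y => (P y).mulVec (fun j => E0hat x j y) i) = 0) := by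
  refine ⟨ae_formalDiv_eq_zero_of_twoScaleTendsto hΩ hε hdivf hfhat,
    ae_formalDiv_eq_zero_of_twoScaleTendsto hΩ hε hdivg hghat,
    ae_formalDiv_eq_zero_of_twoScaleTendsto hΩ' hε hdivB0 hB0hat, ?_⟩
  filter_upwards [ae_formalDiv_mulVec_eq_zero hP hΩ' hε hE0 hdivE0 hE0hat] with x hx
  refine ⟨fun i => ?_, hx⟩
  rw [← Besicovitch.coe_mulVec hP]
  exact Besicovitch.isBesicovitch _

theorem proposition3p1
    (T : ℝ) (hT : 0 < T)
    (ε : ℕ → ℝ) (hε_pos : ∀ n, 0 < ε n) (hε : Tendsto ε atTop (𝓝 0))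
    (P : Euc 3 → Matrix (Fin 3) (Fin 3) ℂ) (hP : IsCoefficient P)
    (f g : ℕ → Euc 4 → Fin 3 → ℂ) (B0 E0 : ℕ → Euc 3 → Fin 3 → ℂ)
    (hf : BoundedL2 (timeSpace T) f) (hg : BoundedL2 (timeSpace T) g)
    (hB0 : BoundedL2 univ B0) (hE0 : BoundedL2 univ E0)
    (hdivf : BoundedDiv Fin.succ (timeSpace T) f)
    (hdivg : BoundedDiv Fin.succ (timeSpace T) g)
    (hdivE0 : BoundedDiv id univ fun n x => (P ((ε n)⁻¹ • x)).mulVec (E0 n x))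
    (hdivB0 : BoundedDiv id univ B0)
    (fhat ghat : Euc 4 → Fin 3 → Besicovitch 4)
    (B0hat E0hat : Euc 3 → Fin 3 → Besicovitch 3)
    (hfhat : ∀ j, TwoScaleTendsto (timeSpace T) ε (fun n z => f n z j) fun z => fhat z j)
    (hghat : ∀ j, TwoScaleTendsto (timeSpace T) ε (fun n z => g n z j) fun z => ghat z j)
    (hB0hat : ∀ j, TwoScaleTendsto univ ε (fun n x => B0 n x j) fun x => B0hat x j)
    (hE0hat : ∀ j, TwoScaleTendsto univ ε (fun n x => E0 n x j) fun x => E0hat x j) :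
    (∀ᵐ z ∂(volume.restrict (timeSpace T)), formalDiv Fin.succ (fun j => fhat z j) = 0) ∧
    (∀ᵐ z ∂(volume.restrict (timeSpace T)), formalDiv Fin.succ (fun j => ghat z j) = 0) ∧
    (∀ᵐ x : Euc 3, formalDiv id (fun j => B0hat x j) = 0) ∧
    (∀ᵐ x : Euc 3,
      (∀ i, IsBesicovitch fun y => (P y).mulVec (fun j => E0hat x j y) i) ∧
      formalDiv id (fun i y => (P y).mulVec (fun j => E0hat x j y) i) = 0) := by
  simpa only [Measure.restrict_univ] using proposition3p1_general (isOpen_timeSpace T) isOpen_univ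
    (tendsto_nhdsWithin_iff.2 ⟨hε, .of_forall hε_pos⟩) hP.isMultiplier hE0 hdivf hdivg hdivE0
    hdivB0 hfhat hghat hB0hat hE0hat
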